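/- Let $p\in(0,1)$ and let $\Lambda$ be a $\sigma$-finite Borel measure on $\mathbb{R}$. \emph{Yule--Simon process.} Let $Z$ be a standard Yule process started from $Z_0=1$ (pure birth process with rate $k$ in state $k$) and $U$ an independent uniform variable on $[0,1]$. The Yule--Simon process with parameter $1/p$ is $Y(t)=\mathbf 1_{\{U\le t\}}Z_{p(\ln t-\ln U)}$, $t\in[0,1]$. \emph{Noise reinforced Poisson process.} An a.s. finite process $(X_t)_{t\ge 0}$ is a noise reinforced Poisson process with rate $c\ge 0$ and reinforcement parameter $p$ if for all $k$, all $0<s_1<\dots<s_k\le t$ and $\lambda_1,\dots,\lambda_k\in\mathbb{R}$, $$\mathbb{E}\Big[e^{i\sum_{j=1}^k\lambda_jX_{s_j}}\Big]=\exp\Big\{(1-p)\,c\,t\;\mathbb{E}\Big[e^{i\sum_{j=1}^k\lambda_jY(s_j/t)}-1\Big]\Big\}.$$ \emph{Noise reinforced Poisson point process (NRPPP).} Let $D=\{T_0,T_1,T_2,\dots\}$ where $T_0=0$ and the increments $T_n-T_{n-1}$, $n\ge1$, are independent and exponentially distributed with parameter $pn$. Let $(A_j)_{j\ge 0}$ be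 a countable partition of $\mathbb{R}$ into Borel sets (some possibly empty) with $\Lambda(A_j)<\infty$. For each $j$ let $\sum_{u\in\mathscr P_j}\delta_{(u,x_u)}$ be a Poisson random measure on $\mathbb{R}_+\times\mathbb{R}$ with intensity $(1-p)\,dt\otimes\Lambda(\cdot\cap A_j)$ and, independently of it, let $(D_u)_{u\in\mathscr P_j}$ be independent copies of $D$; all these objects are independent for different $j$. A random measure on $\mathbb{R}_+\times\mathbb{R}$ is an NRPPP with characteristic measure $\Lambda$ and reinforcement parameter $p$ if it has the same law as $$\sum_j\ \sum_{u\in\mathscr P_j}\ \sum_{t\in D_u}\delta_{(ue^{t},\,x_u)}$$ for such a construction. \textbf{Proposition.} Let $\hat{\mathcal N}$ be a point process (random counting measure) on $\mathbb{R}_+\times\mathbb{R}$ and, for every Borel set $A\subset\mathbb{R}$, let $\hat N_A(t)=\hat{\mathcal N}([0,t]\times A)$, $t\ge0$. Then $\hat{\mathcal N}$ is an NRPPP with characteristic measure $\Lambda$ and reinforcement parameter $p$ if and only if both of the following conditions hold: (i) for every Borel set $A$ with $\Lambda(A)<\infty$, the process $\hat N_A$ is a noise reinforced Poisson process with rate $\Lambda(A)$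 and reinforcement parameter $p$; (ii) for all $k$ and all pairwise disjoint Borel sets $A_1,\dots,A_k$ with $\Lambda(A_i)<\infty$ for every $i$, the processes $\hat N_{A_1},\dots,\hat N_{A_k}$ are independent. -/

import Mathlib

open MeasureTheory ProbabilityTheory
open scoped NNReal ENNReal

noncomputable section

namespace NoiseReinforced

/-- A counting measure: an at most countable sum of unit Dirac masses. -/
def IsCountingMeasure {E : Type*} [MeasurableSpace E] (m : Measure E) : Prop :=
  ∃ (S : Set ℕ) (x : ℕ → E), m = Measure.sum (fun n : S => Measure.dirac (x n))

/-- A point process on `E`: a random measure which is almost surely a counting measure.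
Measurability refers to the σ-algebra on `Measure E` generated by the evaluations. -/
structure IsPointProcess {Ω E : Type*} [MeasurableSpace Ω] [MeasurableSpace E]
    (N : Ω → Measure E) (P : Measure Ω) : Prop where
  measurable : Measurable N
  counting : ∀ᵐ ω ∂P, IsCountingMeasure (N ω)

/-- `M` is a Poisson random measure with intensity `μ`. -/
structure IsPoissonRandomMeasure {Ω E : Type*} [MeasurableSpace Ω] [MeasurableSpace E]
    (M : Ω → Measure E) (μ : Measure E) (P : Measure Ω) : Prop where
  measurable : Measurable M
  hasLaw : ∀ B : Set E, MeasurableSet B → μ B ≠ ∞ →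
    HasLaw (fun ω => M ω B)
      ((poissonMeasure (μ B).toNNReal).map (fun n : ℕ => (n : ℝ≥0∞))) P
  indep : ∀ (k : ℕ) (B : Fin k → Set E), (∀ i, MeasurableSet (B i)) → (∀ i, μ (B i) ≠ ∞) →
    Pairwise (fun i j => Disjoint (B i) (B j)) → iIndepFun (fun i ω => M ω (B i)) P

/-- The law of `(T₀, T₁, T₂, …)`, where `T₀ = 0` and the increments `Tₙ - Tₙ₋₁`, `n ≥ 1`, are
independent and exponentially distributed with parameter `r * n`. For `r = 1` these are `0`
and the successive jump times of a standard Yule process started from `1`. -/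
def birthTimesLaw (r : ℝ) : Measure (ℕ → ℝ) :=
  (Measure.infinitePi (fun n : ℕ => expMeasure (r * ((n : ℝ) + 1)))).map
    (fun e n => ∑ i ∈ Finset.range n, e i)

/-- The Yule process at time `r`, as a function of `0` and its successive jump times:
the number of births up to time `r`, the ancestor (born at time `T 0 = 0`) included. -/
def yule (T : ℕ → ℝ) (r : ℝ) : ℝ := ({n : ℕ | T n ≤ r}.ncard : ℝ)

/-- Canonical probability measure carrying `(U, T)`, where `U` is uniform on `[0,1]` and `T` is an
independent sequence of birth times of a standard Yule process. -/
def yuleSimonMeasure : Measure (ℝ × (ℕ → ℝ)) :=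
  (volume.restrict (Set.Icc (0 : ℝ) 1)).prod (birthTimesLaw 1)

open Classical in
/-- The Yule-Simon process with parameter `1 / p`,
`Y(t) = 1_{U ≤ t} Z_{p (ln t - ln U)}`, on the space of `yuleSimonMeasure`. -/
def yuleSimon (p t : ℝ) (x : ℝ × (ℕ → ℝ)) : ℝ :=
  if x.1 ≤ t then yule x.2 (p * (Real.log t - Real.log x.1)) else 0

/-- `X` is a noise reinforced Poisson process with rate `c` and reinforcement parameter `p`:
it is almost surely finite at each time and its finite-dimensional distributions are given by
`E exp(i ∑ λᵢ X(sᵢ)) = exp((1 - p) c t E[exp(i ∑ λᵢ Y(sᵢ / t)) - 1])` for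
`0 < s₁ < ⋯ < sₖ ≤ t`, with `Y` a Yule-Simon process with parameter `1 / p`. -/
structure IsReinforcedPoissonProcess {Ω : Type*} [MeasurableSpace Ω]
    (c p : ℝ) (X : ℝ≥0 → Ω → ℝ≥0∞) (P : Measure Ω) : Prop where
  measurable : ∀ t, Measurable (X t)
  finite : ∀ t, ∀ᵐ ω ∂P, X t ω ≠ ∞
  charFun : ∀ (k : ℕ) (s : Fin k → ℝ≥0) (t : ℝ≥0) (l : Fin k → ℝ),
    StrictMono s → (∀ i, 0 < s i) → (∀ i, s i ≤ t) →
    ∫ ω, Complex.exp (Complex.I * ((∑ i, l i * (X (s i) ω).toReal : ℝ) : ℂ)) ∂P =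
      Complex.exp (((1 - p) * c * (t : ℝ) : ℝ) *
        ∫ y, (Complex.exp
            (Complex.I * ((∑ i, l i * yuleSimon p ((s i : ℝ) / (t : ℝ)) y : ℝ) : ℂ)) - 1)
          ∂yuleSimonMeasure)

/-- The point measure `∑ δ_{xₙ}`, the sum being over the indices `n` that are in use. -/
def pointMeasure {E : Type*} [MeasurableSpace E] (used : ℕ → Bool) (x : ℕ → E) : Measure E :=
  Measure.sum (fun n => if used n then Measure.dirac (x n) else 0)

/-- Decoration of the points `(uₙ, xₙ)` by the times `D = {T n 0, T n 1, …}`: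
the measure `∑ₙ ∑_{t ∈ Dₙ} δ_{(uₙ e^t, xₙ)}`, over the indices `n` that are in use. -/
def decoratedMeasure (used : ℕ → Bool) (x : ℕ → ℝ≥0 × ℝ) (T : ℕ → ℕ → ℝ) :
    Measure (ℝ≥0 × ℝ) :=
  Measure.sum (fun n => if used n then
    Measure.sum (fun k => Measure.dirac ((x n).1 * (Real.exp (T n k)).toNNReal, (x n).2)) else 0)

/-- Lebesgue measure on `ℝ₊ = [0, ∞)`. -/
def lebesgueNNReal : Measure ℝ≥0 :=
  (volume.restrict (Set.Ici (0 : ℝ))).map Real.toNNReal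

/-- The ingredients of a noise reinforced Poisson point process with finite characteristic
measure `Λ`: a (measurably enumerated) Poisson random measure `∑ δ_{(u, x_u)}` with intensity
`(1 - p) dt ⊗ Λ`, and an independent family of i.i.d. sequences, each distributed as
`birthTimesLaw p`, one for each atom. -/
structure IsPoissonWithDecorations {Ω : Type*} [MeasurableSpace Ω]
    (Λ : Measure ℝ) (p : ℝ) (used : ℕ → Ω → Bool) (x : ℕ → Ω → ℝ≥0 × ℝ)
    (T : ℕ → Ω → ℕ → ℝ) (P : Measure Ω) : Prop where
  measurable_used : ∀ n, Measurable (used n)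
  measurable_point : ∀ n, Measurable (x n)
  measurable_times : ∀ n, Measurable (T n)
  poisson : IsPoissonRandomMeasure (fun ω => pointMeasure (fun n => used n ω) (fun n => x n ω))
    (ENNReal.ofReal (1 - p) • lebesgueNNReal.prod Λ) P
  law_times : ∀ n, HasLaw (T n) (birthTimesLaw p) P
  indep_times : iIndepFun T P
  indep_points_times : IndepFun (fun ω n => (used n ω, x n ω)) (fun ω n => T n ω) P

/-- `N` is a noise reinforced Poisson point process with characteristic measure `Λ` and
reinforcement parameter `p`: it has the law of a superposition `∑ⱼ Nⱼ`, where `(Aⱼ)` is a countable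
partition of `ℝ` into Borel sets of finite `Λ`-measure and the `Nⱼ` are built by decoration, with
characteristic measures `Λ(· ∩ Aⱼ)`, from independent ingredients. -/
def IsReinforcedPoissonPointProcess {Ω : Type*} [MeasurableSpace Ω]
    (Λ : Measure ℝ) (p : ℝ) (N : Ω → Measure (ℝ≥0 × ℝ)) (P : Measure Ω) : Prop :=
  ∃ (Ω' : Type) (_ : MeasurableSpace Ω') (P' : Measure Ω') (A : ℕ → Set ℝ)
    (used : ℕ → ℕ → Ω' → Bool) (x : ℕ → ℕ → Ω' → ℝ≥0 × ℝ) (T : ℕ → ℕ → Ω' → ℕ → ℝ),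
    IsProbabilityMeasure P' ∧
    (∀ j, MeasurableSet (A j)) ∧
    Pairwise (fun i j => Disjoint (A i) (A j)) ∧
    (⋃ j, A j) = Set.univ ∧
    (∀ j, Λ (A j) < ∞) ∧
    (∀ j, IsPoissonWithDecorations (Λ.restrict (A j)) p (used j) (x j) (T j) P') ∧
    iIndepFun (fun j ω n => (used j n ω, x j n ω, T j n ω)) P' ∧
    P.map N = P'.map (fun ω => Measure.sum (fun j =>
      decoratedMeasure (fun n => used j n ω) (fun n => x j n ω) (fun n => T j n ω)))

/-- The counting process `N_A(t) = N([0,t] × A)`. -/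
def countingProcess {Ω : Type*} (N : Ω → Measure (ℝ≥0 × ℝ)) (A : Set ℝ) (t : ℝ≥0) (ω : Ω) :
    ℝ≥0∞ :=
  N ω (Set.Icc 0 t ×ˢ A)

end NoiseReinforced

end

namespace NoiseReinforced

open Filter Topology Complex

/-! ### Characteristic functions, independence and infinite products -/

section Generic

variable {Ω Ω' : Type*} [MeasurableSpace Ω] [MeasurableSpace Ω'] {P : Measure Ω} {P' : Measure Ω'}

/-! Both directions rest on one formula. Let Φ(y) be the joint characteristic function of the
numbers of points in [0, s_a] × B_a of a single cluster with ancestor y (`clusterTransform`). For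
the superposition N of the decorated Poisson measures, E exp(i ∑ l_a N([0, s_a] × B_a)) = exp ∫ (Φ -
1) d((1 - p) dt ⊗ Λ); this is `IsReinforcedConstruction.integral_exp`. Within one block of the
partition, averaging over the independent decorations replaces each cluster by Φ at its ancestor,
and the exponential formula for Poisson random measures applies. Independent blocks multiply, so
their exponents add up. Non-explosion of the birth times keeps all counts finite.

Condition (i) is the case where all B_a equal one set A. Then Φ - 1 is a function of time multiplied
by the indicator of A, and the substitution u = tv, with v uniform and birth times divided by p,
turns the time integral into the Yule-Simon expectation. Condition (ii) holds because all points of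
a cluster carry the same mark: for disjoint sets Φ - 1 is a sum of one term per set, so the joint
characteristic function factorises.

The converse is uniqueness in law (`HasReinforcedCounts.map_eq`). Cutting finitely many sets into
disjoint atoms, (i) and (ii) determine the joint law of the counts of rectangles [0, t] × A. These
rectangles form a generating π-system on which the counts are almost surely finite, and so determine
the law of the random measure (`map_randomMeasure_eq`). A construction exists
(`exists_isReinforcedConstruction`) and satisfies (i) and (ii) by the direct part, hence it has the
law of N. -/

lemma norm_exp_I_mul (r : ℝ) : ‖exp (I * (r : ℂ))‖ = 1 := by
  rw [mul_comm]; exact norm_exp_ofReal_mul_I r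

lemma integrable_of_norm_le_one [IsFiniteMeasure P] {f : Ω → ℂ} (hf : AEStronglyMeasurable f P)
    (h : ∀ ω, ‖f ω‖ ≤ 1) : Integrable f P :=
  Integrable.of_bound hf 1 (ae_of_all _ h)

lemma tendsto_integral_of_norm_le_one [IsFiniteMeasure P] {F : ℕ → Ω → ℂ} {f : Ω → ℂ}
    (hF : ∀ n, AEStronglyMeasurable (F n) P) (h : ∀ n ω, ‖F n ω‖ ≤ 1)
    (hlim : ∀ᵐ ω ∂P, Tendsto (fun n => F n ω) atTop (𝓝 (f ω))) :
    Tendsto (fun n => ∫ ω, F n ω ∂P) atTop (𝓝 (∫ ω, f ω ∂P)) :=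
  tendsto_integral_of_dominated_convergence (fun _ => 1) hF (integrable_const 1)
    (fun n => ae_of_all _ (h n)) hlim

lemma norm_prod_le_one {ι : Type*} (s : Finset ι) {f : ι → ℂ} (h : ∀ i, ‖f i‖ ≤ 1) :
    ‖∏ i ∈ s, f i‖ ≤ 1 := by
  rw [norm_prod]
  exact Finset.prod_le_one (fun _ _ => norm_nonneg _) (fun i _ => h i)

/-- Independence gives the partial products, and bounded convergence passes to the limit. It is used
twice: over the blocks of the partition of the line, and over the samples that build a Poisson
random measure. -/
lemma integral_eq_exp_of_hasSum [IsProbabilityMeasure P] {F : ℕ → Ω → ℂ} {f : Ω → ℂ}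
    {z : ℕ → ℂ} {w : ℂ} (hF : ∀ n, Measurable (F n)) (h : ∀ n ω, ‖F n ω‖ ≤ 1)
    (hind : iIndepFun F P) (hint : ∀ n, ∫ ω, F n ω ∂P = exp (z n)) (hz : HasSum z w)
    (hlim : ∀ᵐ ω ∂P, Tendsto (fun m => ∏ n ∈ Finset.range m, F n ω) atTop (𝓝 (f ω))) :
    ∫ ω, f ω ∂P = exp w := by
  have h1 : Tendsto (fun m => ∫ ω, ∏ n ∈ Finset.range m, F n ω ∂P) atTop (𝓝 (∫ ω, f ω ∂P)) := by
    refine tendsto_integral_of_norm_le_one (fun m => ?_) (fun m ω => ?_) hlim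
    · exact (Finset.measurable_prod _ fun n _ => hF n).aestronglyMeasurable
    · exact norm_prod_le_one _ fun i => h i ω
  have h2 : ∀ m, ∫ ω, ∏ n ∈ Finset.range m, F n ω ∂P = exp (∑ n ∈ Finset.range m, z n) := by
    intro m
    have := (hind.restrict (Finset.range m)).integral_fun_prod_eq_prod_integral
      (fun i => (hF i).aestronglyMeasurable)
    simp only [Finset.restrict] at this
    rw [Finset.prod_coe_sort (Finset.range m) (fun n => ∫ ω, F n ω ∂P)] at this
    rw [exp_sum, ← Finset.prod_congr rfl (fun n _ => hint n), ← this]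
    exact integral_congr_ae (ae_of_all _ fun ω =>
      (Finset.prod_coe_sort (Finset.range m) (fun n => F n ω)).symm)
  simp_rw [h2] at h1
  exact tendsto_nhds_unique h1 ((continuous_exp.tendsto w).comp hz.tendsto_sum_nat)

lemma integral_pow_poissonMeasure (r : ℝ≥0) (c : ℂ) :
    ∫ n, c ^ n ∂(poissonMeasure r) = exp (r * (c - 1)) := by
  rw [integral_poissonMeasure]
  have h : ∀ n : ℕ, (Real.exp (-r) * (r : ℝ) ^ n / n.factorial) • c ^ n
      = exp (-r) * ((r * c) ^ n / n.factorial) := by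
    intro n
    rw [Complex.real_smul]
    push_cast
    ring
  simp_rw [h]
  rw [tsum_mul_left, (NormedSpace.expSeries_div_hasSum_exp ((r : ℂ) * c)).tsum_eq,
    ← Complex.exp_eq_exp_ℂ, mul_sub, mul_one, sub_eq_neg_add, exp_add]

lemma lintegral_poissonMeasure_natCast (r : ℝ≥0) :
    ∫⁻ n, (n : ℝ≥0∞) ∂(poissonMeasure r) = r := by
  have h1 : ∀ n : ℕ, ENNReal.ofReal (Real.exp (-r) * (r : ℝ) ^ (n + 1) / (n + 1).factorial)
      * ((n + 1 : ℕ) : ℝ≥0∞) = r * poissonMeasure r {n} := by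
    intro n
    rw [poissonMeasure_singleton, ← ENNReal.ofReal_coe_nnreal, ← ENNReal.ofReal_natCast,
      ← ENNReal.ofReal_mul (by positivity), ← ENNReal.ofReal_mul (by positivity)]
    congr 1
    rw [Nat.factorial_succ]
    have : (n.factorial : ℝ) ≠ 0 := by positivity
    have : ((n : ℝ) + 1) ≠ 0 := by positivity
    push_cast
    field_simp
    ring
  have h2 : ∑' n : ℕ, poissonMeasure r {n} = 1 := by
    rw [← measure_univ (μ := poissonMeasure r), ← Set.iUnion_of_singleton ℕ,
      measure_iUnion (by intro i j hij; simpa using hij) (fun _ => MeasurableSet.of_discrete)]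
  rw [lintegral_countable', tsum_eq_zero_add' ENNReal.summable]
  simp_rw [poissonMeasure_singleton r (_ + 1), mul_comm ((_ : ℕ) : ℝ≥0∞), h1]
  rw [ENNReal.tsum_mul_left, h2]
  simp

/-- Every continuous linear form on `ι → ℝ` is given by its values on the basis vectors, so the
hypothesis is equality of the characteristic functions on the dual. -/
lemma map_eq_of_integral_exp_eq [IsProbabilityMeasure P] [IsProbabilityMeasure P'] {ι : Type*}
    [Fintype ι] {X : ι → Ω → ℝ} {Y : ι → Ω' → ℝ} (hX : ∀ i, Measurable (X i))
    (hY : ∀ i, Measurable (Y i))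
    (h : ∀ l : ι → ℝ, ∫ ω, exp (I * ((∑ i, l i * X i ω : ℝ) : ℂ)) ∂P
      = ∫ ω, exp (I * ((∑ i, l i * Y i ω : ℝ) : ℂ)) ∂P') :
    P.map (fun ω i => X i ω) = P'.map (fun ω i => Y i ω) := by
  classical
  have mX : Measurable (fun ω i => X i ω) := measurable_pi_lambda _ hX
  have mY : Measurable (fun ω i => Y i ω) := measurable_pi_lambda _ hY
  have := Measure.isProbabilityMeasure_map mX.aemeasurable (μ := P)
  have := Measure.isProbabilityMeasure_map mY.aemeasurable (μ := P')
  refine Measure.ext_of_charFunDual ?_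
  ext L
  have hL : ∀ v : ι → ℝ, (L v : ℂ) * I = I * ((∑ i, L (Pi.single i 1) * v i : ℝ) : ℂ) := by
    intro v
    rw [mul_comm]
    congr 2
    have := LinearMap.pi_apply_eq_sum_univ (L : (ι → ℝ) →ₗ[ℝ] ℝ) v
    simp only [ContinuousLinearMap.coe_coe, smul_eq_mul] at this
    rw [this]
    refine Finset.sum_congr rfl fun i _ => ?_
    rw [mul_comm]
    congr 2
    ext j
    simp [Pi.single_apply, eq_comm]
  rw [charFunDual_apply, charFunDual_apply, integral_map mX.aemeasurable
    (by fun_prop), integral_map mY.aemeasurable (by fun_prop)]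
  simp_rw [hL]
  exact h _

lemma iIndepFun_of_integral_exp [IsProbabilityMeasure P] {ι : Type*} [Fintype ι] {κ : ι → Type*}
    [∀ i, Fintype (κ i)] {X : (i : ι) → κ i → Ω → ℝ} (hX : ∀ i j, Measurable (X i j))
    (h : ∀ l : (i : ι) → κ i → ℝ, ∫ ω, exp (I * ((∑ i, ∑ j, l i j * X i j ω : ℝ) : ℂ)) ∂P
      = ∏ i, ∫ ω, exp (I * ((∑ j, l i j * X i j ω : ℝ) : ℂ)) ∂P) :
    iIndepFun (fun i ω j => X i j ω) P := by
  classical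
  have mX : ∀ i, Measurable (fun ω j => X i j ω) := fun i => measurable_pi_lambda _ (hX i)
  have mX' : Measurable (fun ω i j => X i j ω) := measurable_pi_lambda _ mX
  rw [iIndepFun_iff_charFunDual_pi (fun i => (mX i).aemeasurable)]
  intro L
  let l : (i : ι) → κ i → ℝ := fun i j => L (Pi.single i (Pi.single j 1))
  have h1 : ∀ i (v : κ i → ℝ), L (Pi.single i v) = ∑ j, l i j * v j := by
    intro i v
    have := LinearMap.pi_apply_eq_sum_univ
      ((L.comp (.single ℝ (fun i => κ i → ℝ) i) : (κ i → ℝ) →L[ℝ] ℝ) : (κ i → ℝ) →ₗ[ℝ] ℝ) v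
    simp only [ContinuousLinearMap.coe_coe, smul_eq_mul, ContinuousLinearMap.comp_apply,
      ContinuousLinearMap.single_apply] at this
    rw [this]
    refine Finset.sum_congr rfl fun j _ => ?_
    rw [mul_comm]
    congr 3
    ext j'
    simp [Pi.single_apply, eq_comm]
  have h2 : ∀ v : (i : ι) → κ i → ℝ, L v = ∑ i, ∑ j, l i j * v i j := by
    intro v
    conv_lhs => rw [← Finset.univ_sum_single v, map_sum]
    exact Finset.sum_congr rfl fun i _ => h1 i _
  rw [charFunDual_apply, integral_map mX'.aemeasurable (by fun_prop)]
  simp_rw [charFunDual_apply]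
  have h3 : ∀ i, ∫ v, exp ((L.comp (.single ℝ (fun i => κ i → ℝ) i) v : ℂ) * I)
      ∂P.map (fun ω j => X i j ω) = ∫ ω, exp (I * ((∑ j, l i j * X i j ω : ℝ) : ℂ)) ∂P := by
    intro i
    rw [integral_map (mX i).aemeasurable (by fun_prop)]
    simp_rw [ContinuousLinearMap.comp_apply, ContinuousLinearMap.single_apply, h1, mul_comm I]
  simp_rw [h3, h2, ← h l, mul_comm I]

/-- Almost sure finiteness is what makes `ENNReal.ofReal` undo `toReal`, which sends `∞` to `0`. -/
lemma map_eq_of_integral_exp_toReal_eq [IsProbabilityMeasure P] [IsProbabilityMeasure P']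
    {ι : Type*} [Fintype ι] {X : ι → Ω → ℝ≥0∞} {Y : ι → Ω' → ℝ≥0∞} (hX : ∀ i, Measurable (X i))
    (hY : ∀ i, Measurable (Y i)) (hX' : ∀ i, ∀ᵐ ω ∂P, X i ω ≠ ∞)
    (hY' : ∀ i, ∀ᵐ ω ∂P', Y i ω ≠ ∞)
    (h : ∀ l : ι → ℝ, ∫ ω, exp (I * ((∑ i, l i * (X i ω).toReal : ℝ) : ℂ)) ∂P
      = ∫ ω, exp (I * ((∑ i, l i * (Y i ω).toReal : ℝ) : ℂ)) ∂P') :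
    P.map (fun ω i => X i ω) = P'.map (fun ω i => Y i ω) := by
  have key := map_eq_of_integral_exp_eq (X := fun i ω => (X i ω).toReal)
    (Y := fun i ω => (Y i ω).toReal) (fun i => (hX i).ennreal_toReal)
    (fun i => (hY i).ennreal_toReal) h
  have hm : Measurable (fun (v : ι → ℝ) i => ENNReal.ofReal (v i)) := by fun_prop
  have key2 := congrArg (fun μ => Measure.map (fun (v : ι → ℝ) i => ENNReal.ofReal (v i)) μ) key
  beta_reduce at key2
  rw [Measure.map_map hm (measurable_pi_lambda _ fun i => (hX i).ennreal_toReal),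
    Measure.map_map hm (measurable_pi_lambda _ fun i => (hY i).ennreal_toReal)] at key2
  have e1 : (fun ω i => X i ω) =ᵐ[P]
      (fun (v : ι → ℝ) i => ENNReal.ofReal (v i)) ∘ (fun ω i => (X i ω).toReal) := by
    filter_upwards [ae_all_iff.2 hX'] with ω hω
    funext i
    simp [ENNReal.ofReal_toReal (hω i)]
  have e2 : (fun ω i => Y i ω) =ᵐ[P']
      (fun (v : ι → ℝ) i => ENNReal.ofReal (v i)) ∘ (fun ω i => (Y i ω).toReal) := by
    filter_upwards [ae_all_iff.2 hY'] with ω hω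
    funext i
    simp [ENNReal.ofReal_toReal (hω i)]
  rw [Measure.map_congr e1, Measure.map_congr e2, key2]

lemma iIndepFun_of_integral_exp_toReal [IsProbabilityMeasure P] {ι : Type*} [Fintype ι]
    {κ : ι → Type*} [∀ i, Fintype (κ i)] {X : (i : ι) → κ i → Ω → ℝ≥0∞}
    (hX : ∀ i j, Measurable (X i j)) (hX' : ∀ i j, ∀ᵐ ω ∂P, X i j ω ≠ ∞)
    (h : ∀ l : (i : ι) → κ i → ℝ,
      ∫ ω, exp (I * ((∑ i, ∑ j, l i j * (X i j ω).toReal : ℝ) : ℂ)) ∂P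
      = ∏ i, ∫ ω, exp (I * ((∑ j, l i j * (X i j ω).toReal : ℝ) : ℂ)) ∂P) :
    iIndepFun (fun i ω j => X i j ω) P := by
  have key := iIndepFun_of_integral_exp (X := fun i j ω => (X i j ω).toReal)
    (fun i j => (hX i j).ennreal_toReal) h
  have key2 := key.comp (fun i (v : κ i → ℝ) j => ENNReal.ofReal (v j)) (fun i => by fun_prop)
  refine iIndepFun.process_congr
    (X := fun i j ω => ENNReal.ofReal (X i j ω).toReal) key2 fun i j => ?_
  filter_upwards [hX' i j] with ω hω
  simp [ENNReal.ofReal_toReal hω]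

lemma iIndepFun_comp_iff {ι : Type*} {β : ι → Type*} [∀ i, MeasurableSpace (β i)]
    {f : (i : ι) → Ω → β i} (hf : ∀ i, Measurable (f i)) {φ : Ω' → Ω}
    (hφ : MeasurePreserving φ P' P) :
    iIndepFun (fun i ω => f i (φ ω)) P' ↔ iIndepFun f P := by
  rw [iIndepFun_iff_measure_inter_preimage_eq_mul, iIndepFun_iff_measure_inter_preimage_eq_mul]
  refine forall_congr' fun S => forall_congr' fun s => forall_congr' fun hs => ?_
  have h1 : ∀ i ∈ S, P' ((fun ω => f i (φ ω)) ⁻¹' s i) = P (f i ⁻¹' s i) := fun i hi =>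
    hφ.measure_preimage (hf i (hs i hi)).nullMeasurableSet
  have h2 : P' (⋂ i ∈ S, (fun ω => f i (φ ω)) ⁻¹' s i) = P (⋂ i ∈ S, f i ⁻¹' s i) := by
    rw [← hφ.measure_preimage (S.measurableSet_biInter
      fun i hi => hf i (hs i hi)).nullMeasurableSet]
    simp only [Set.preimage_iInter]
    rfl
  rw [h2, Finset.prod_congr rfl h1]

end Generic

/-! ### Birth times of the Yule process: scaling and non-explosion -/

section BirthTimes

lemma expMeasure_eq_withDensity (a : ℝ) : expMeasure a = volume.withDensity (exponentialPDF a) :=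
  rfl

lemma measurable_exponentialPDF (a : ℝ) : Measurable (exponentialPDF a) :=
  (measurable_exponentialPDFReal a).ennreal_ofReal

lemma map_div_expMeasure {r a : ℝ} (hr : 0 < r) (ha : 0 < a) :
    (expMeasure a).map (fun y => y / r) = expMeasure (r * a) := by
  have := isProbabilityMeasure_expMeasure ha
  have := isProbabilityMeasure_expMeasure (mul_pos hr ha)
  have hm : Measurable (fun y : ℝ => y / r) := by fun_prop
  have := Measure.isProbabilityMeasure_map hm.aemeasurable (μ := expMeasure a)
  refine Measure.eq_of_cdf _ _ ?_
  ext x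
  rw [cdf_expMeasure_eq (mul_pos hr ha), cdf_eq_real, map_measureReal_apply hm measurableSet_Iic]
  have : (fun y : ℝ => y / r) ⁻¹' Set.Iic x = Set.Iic (x * r) := by
    ext y
    simp [div_le_iff₀ hr]
  rw [this, ← cdf_eq_real, cdf_expMeasure_eq ha]
  have h0 : 0 ≤ x * r ↔ 0 ≤ x := by constructor <;> intro h <;> nlinarith
  simp only [h0, show a * (x * r) = r * a * x by ring]

lemma ae_expMeasure_nonneg (a : ℝ) : ∀ᵐ y ∂expMeasure a, 0 ≤ y := by
  have h : expMeasure a (Set.Iio 0) = 0 := by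
    rw [expMeasure_eq_withDensity, withDensity_apply _ measurableSet_Iio,
      lintegral_exponentialPDF_of_nonpos le_rfl]
  rw [ae_iff]
  convert! h using 2
  ext y
  simp

lemma lintegral_exp_neg_expMeasure {a : ℝ} (ha : 0 < a) :
    ∫⁻ y, ENNReal.ofReal (Real.exp (-y)) ∂expMeasure a = ENNReal.ofReal (a / (a + 1)) := by
  have h1 : ∀ y, exponentialPDF a y * ENNReal.ofReal (Real.exp (-y))
      = ENNReal.ofReal (a / (a + 1)) * exponentialPDF (a + 1) y := by
    intro y
    rw [exponentialPDF_eq, exponentialPDF_eq, ← ENNReal.ofReal_mul' (Real.exp_pos _).le,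
      ← ENNReal.ofReal_mul (by positivity)]
    congr 1
    split_ifs
    · rw [mul_assoc, ← Real.exp_add]
      field_simp
      congr 1
      ring
    · simp
  rw [expMeasure_eq_withDensity, lintegral_withDensity_eq_lintegral_mul _
    (measurable_exponentialPDF a) (by fun_prop)]
  simp only [Pi.mul_apply, h1]
  rw [lintegral_const_mul _ (measurable_exponentialPDF _),
    lintegral_exponentialPDF_eq_one (by linarith), mul_one]

lemma mgf_expMeasure_neg_one {a : ℝ} (ha : 0 < a) :
    mgf id (expMeasure a) (-1) = a / (a + 1) := by
  rw [mgf]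
  simp only [id, neg_mul, one_mul]
  rw [integral_eq_lintegral_of_nonneg_ae (ae_of_all _ fun _ => (Real.exp_pos _).le)
    (by fun_prop), lintegral_exp_neg_expMeasure ha, ENNReal.toReal_ofReal (by positivity)]

lemma measurable_sum_range : Measurable (fun (e : ℕ → ℝ) (n : ℕ) => ∑ i ∈ Finset.range n, e i) := by
  fun_prop

lemma isProbabilityMeasure_expMeasure_mul_succ {r : ℝ} (hr : 0 < r) (n : ℕ) :
    IsProbabilityMeasure (expMeasure (r * ((n : ℝ) + 1))) :=
  isProbabilityMeasure_expMeasure (by positivity)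

lemma isProbabilityMeasure_birthTimesLaw {r : ℝ} (hr : 0 < r) :
    IsProbabilityMeasure (birthTimesLaw r) := by
  have := isProbabilityMeasure_expMeasure_mul_succ hr
  exact Measure.isProbabilityMeasure_map measurable_sum_range.aemeasurable

/-- An exponential variable of parameter ra is one of parameter a divided by r. This reconciles the
cluster times, of rate pn, with the standard Yule process run at speed p in the Yule-Simon process.
-/
lemma birthTimesLaw_eq_map {r : ℝ} (hr : 0 < r) :
    birthTimesLaw r = (birthTimesLaw 1).map (fun T n => T n / r) := by
  have := isProbabilityMeasure_expMeasure_mul_succ one_pos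
  have h1 : (fun n : ℕ => expMeasure (r * ((n : ℝ) + 1)))
      = fun n : ℕ => (expMeasure (1 * ((n : ℝ) + 1))).map (fun y => y / r) := by
    funext n
    rw [map_div_expMeasure hr (by positivity), one_mul]
  have h2 := Measure.infinitePi_map_pi (fun n : ℕ => expMeasure (1 * ((n : ℝ) + 1)))
    (f := fun _ y => y / r) (fun _ => by fun_prop)
  rw [birthTimesLaw, h1, ← h2, Measure.map_map measurable_sum_range (by fun_prop), birthTimesLaw,
    Measure.map_map (by fun_prop) measurable_sum_range]
  congr 1
  funext e n
  simp [Finset.sum_div]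

/-- Sequences of birth times that start at `0`, are nondecreasing and do not accumulate. -/
def IsBirthTimes (T : ℕ → ℝ) : Prop :=
  T 0 = 0 ∧ (∀ n, T n ≤ T (n + 1)) ∧ ∀ m : ℕ, ∃ n, (m : ℝ) < T n

lemma measurableSet_isBirthTimes : MeasurableSet {T | IsBirthTimes T} := by
  unfold IsBirthTimes
  measurability

lemma IsBirthTimes.monotone {T : ℕ → ℝ} (hT : IsBirthTimes T) : Monotone T :=
  monotone_nat_of_le_succ hT.2.1

lemma IsBirthTimes.nonneg {T : ℕ → ℝ} (hT : IsBirthTimes T) (n : ℕ) : 0 ≤ T n :=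
  hT.1 ▸ hT.monotone n.zero_le

lemma IsBirthTimes.finite {T : ℕ → ℝ} (hT : IsBirthTimes T) (x : ℝ) : {n | T n ≤ x}.Finite := by
  obtain ⟨m, hm⟩ := exists_nat_ge x
  obtain ⟨k, hk⟩ := hT.2.2 m
  refine (Set.finite_lt_nat k).subset fun n hn => ?_
  by_contra h
  have := hT.monotone (not_lt.1 h)
  have hn : T n ≤ x := hn
  linarith

lemma IsBirthTimes.div {T : ℕ → ℝ} (hT : IsBirthTimes T) {r : ℝ} (hr : 0 < r) :
    IsBirthTimes (fun n => T n / r) := by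
  refine ⟨by simp [hT.1], fun n => ?_, fun m => ?_⟩
  · exact div_le_div_of_nonneg_right (hT.2.1 n) hr.le
  · obtain ⟨k, hk⟩ := exists_nat_ge ((m : ℝ) * r)
    obtain ⟨n, hn⟩ := hT.2.2 k
    exact ⟨n, (lt_div_iff₀ hr).2 (hk.trans_lt hn)⟩

/-- The factors are the values E exp(-e_i) for the increments e_i, so this telescoping product is E
exp(-T_n). -/
lemma prod_range_succ_div (n : ℕ) :
    ∏ i ∈ Finset.range n, ((1 * ((i : ℝ) + 1)) / (1 * ((i : ℝ) + 1) + 1)) = 1 / ((n : ℝ) + 1) := by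
  induction n with
  | zero => simp
  | succ n ih =>
    rw [Finset.prod_range_succ, ih]
    push_cast
    have : (n : ℝ) + 1 ≠ 0 := by positivity
    field_simp

/-- Non-explosion by a Chernoff bound: P(T_n ≤ m) ≤ e^m E exp(-T_n) = e^m / (n + 1), which tends to
0, so almost surely no m bounds all the T_n. -/
lemma ae_isBirthTimes_one : ∀ᵐ T ∂birthTimesLaw 1, IsBirthTimes T := by
  have hprob := isProbabilityMeasure_expMeasure_mul_succ one_pos
  set μ := Measure.infinitePi (fun n : ℕ => expMeasure (1 * ((n : ℝ) + 1))) with hμ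
  rw [birthTimesLaw, ae_map_iff measurable_sum_range.aemeasurable measurableSet_isBirthTimes]
  have hev : ∀ n, μ.map (fun e => e n) = expMeasure (1 * ((n : ℝ) + 1)) := fun n =>
    Measure.infinitePi_map_eval _ n
  have hmgf : ∀ n, mgf (fun e : ℕ → ℝ => e n) μ (-1)
      = (1 * ((n : ℝ) + 1)) / (1 * ((n : ℝ) + 1) + 1) := by
    intro n
    rw [← mgf_expMeasure_neg_one (by positivity), ← hev n, mgf_id_map (measurable_pi_apply n).aemeasurable]
  have hind : iIndepFun (fun n (e : ℕ → ℝ) => e n) μ :=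
    iIndepFun_infinitePi (X := fun _ y => y) (fun _ => measurable_id)
  have hnn : ∀ᵐ e ∂μ, ∀ n, 0 ≤ e n := by
    rw [ae_all_iff]
    intro n
    have := ae_expMeasure_nonneg (1 * ((n : ℝ) + 1))
    rw [← hev n] at this
    exact ae_of_ae_map (measurable_pi_apply n).aemeasurable this
  have hbound : ∀ (m n : ℕ), μ.real {e | ∑ i ∈ Finset.range n, e i ≤ m}
      ≤ Real.exp m * (1 / ((n : ℝ) + 1)) := by
    intro m n
    have hsum : (fun e : ℕ → ℝ => ∑ i ∈ Finset.range n, e i)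
        = ∑ i ∈ Finset.range n, (fun e : ℕ → ℝ => e i) := by
      funext e
      simp
    have h := measure_le_le_exp_mul_mgf (μ := μ)
      (X := fun e : ℕ → ℝ => ∑ i ∈ Finset.range n, e i) (t := -1) m (by norm_num) ?_
    · rw [hsum, hind.mgf_sum (fun _ => by fun_prop), Finset.prod_congr rfl (fun i _ => hmgf i),
        prod_range_succ_div] at h
      simpa using h
    · refine Integrable.of_bound (by fun_prop) 1 ?_
      filter_upwards [hnn] with e he
      rw [Real.norm_of_nonneg (Real.exp_pos _).le, Real.exp_le_one_iff]
      have : 0 ≤ ∑ i ∈ Finset.range n, e i := Finset.sum_nonneg fun i _ => he i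
      linarith
  have hesc : ∀ᵐ e ∂μ, ∀ m : ℕ, ∃ n, (m : ℝ) < ∑ i ∈ Finset.range n, e i := by
    rw [ae_all_iff]
    intro m
    rw [ae_iff]
    rw [← measureReal_eq_zero_iff]
    have hlim : Tendsto (fun n : ℕ => Real.exp m * (1 / ((n : ℝ) + 1))) atTop (𝓝 0) := by
      simpa using tendsto_one_div_add_atTop_nhds_zero_nat.const_mul (Real.exp m)
    refine le_antisymm (ge_of_tendsto' hlim fun n => ?_) measureReal_nonneg
    refine (measureReal_mono ?_).trans (hbound m n)
    intro e he
    simp only [not_exists, not_lt, Set.mem_ofPred_eq] at he ⊢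
    exact he n
  filter_upwards [hnn, hesc] with e h1 h2
  refine ⟨by simp, fun n => ?_, h2⟩
  simpa [Finset.sum_range_succ] using h1 n

lemma ae_isBirthTimes {r : ℝ} (hr : 0 < r) : ∀ᵐ T ∂birthTimesLaw r, IsBirthTimes T := by
  rw [birthTimesLaw_eq_map hr, ae_map_iff
    (Measurable.aemeasurable (by fun_prop)) measurableSet_isBirthTimes]
  filter_upwards [ae_isBirthTimes_one] with T hT using hT.div hr

end BirthTimes

/-! ### The exponential formula for Poisson random measures -/

section PoissonFunctional

variable {Ω E : Type*} [MeasurableSpace Ω] [MeasurableSpace E] {P : Measure Ω}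

lemma pointMeasure_apply (used : ℕ → Bool) (x : ℕ → E) {B : Set E} (hB : MeasurableSet B) :
    pointMeasure used x B = ∑' n, if used n then B.indicator 1 (x n) else 0 := by
  rw [pointMeasure, Measure.sum_apply _ hB]
  refine tsum_congr fun n => ?_
  split_ifs with h
  · rw [Measure.dirac_apply' _ hB]
  · simp

lemma pointMeasure_apply_eq_card (used : ℕ → Bool) (x : ℕ → E) {B : Set E} (hB : MeasurableSet B)
    (S : Finset ℕ) (hS : ∀ n, n ∈ S ↔ used n = true ∧ x n ∈ B) :
    pointMeasure used x B = (S.card : ℝ≥0∞) := by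
  rw [pointMeasure_apply _ _ hB, tsum_eq_sum (s := S), Finset.card_eq_sum_ones, Nat.cast_sum]
  · refine Finset.sum_congr rfl fun n hn => ?_
    have := (hS n).1 hn
    simp [this.1, this.2]
  · intro n hn
    have h := mt (hS n).2 hn
    split_ifs with hu
    · simp only [not_and] at h
      simp [h hu]
    · rfl

lemma finite_of_pointMeasure_ne_top (used : ℕ → Bool) (x : ℕ → E) {B : Set E}
    (hB : MeasurableSet B) (h : pointMeasure used x B ≠ ∞) :
    {n | used n = true ∧ x n ∈ B}.Finite := by
  rw [pointMeasure_apply _ _ hB] at h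
  refine (ENNReal.finite_const_le_of_tsum_ne_top h one_ne_zero).subset fun n hn => ?_
  have : used n = true ∧ x n ∈ B := hn
  simp [this.1, this.2]

variable {M : Ω → Measure E} {μ : Measure E}

lemma IsPoissonRandomMeasure.lintegral_apply (hM : IsPoissonRandomMeasure M μ P) {B : Set E}
    (hB : MeasurableSet B) (hμB : μ B ≠ ∞) : ∫⁻ ω, M ω B ∂P = μ B := by
  have h := (hM.hasLaw B hB hμB).lintegral_comp (f := fun y => y) (by fun_prop)
  rw [h, lintegral_map (by fun_prop) .of_discrete, lintegral_poissonMeasure_natCast,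
    ENNReal.coe_toNNReal hμB]

lemma IsPoissonRandomMeasure.ae_ne_top (hM : IsPoissonRandomMeasure M μ P) {B : Set E}
    (hB : MeasurableSet B) (hμB : μ B ≠ ∞) : ∀ᵐ ω ∂P, M ω B ≠ ∞ := by
  have h := ae_lt_top (Measure.measurable_measure.1 hM.measurable B hB)
    (by rw [hM.lintegral_apply hB hμB]; exact hμB)
  filter_upwards [h] with ω hω using hω.ne

lemma IsPoissonRandomMeasure.indep_fintype (hM : IsPoissonRandomMeasure M μ P) {ι : Type*}
    [Fintype ι] (B : ι → Set E) (hB : ∀ i, MeasurableSet (B i)) (hμB : ∀ i, μ (B i) ≠ ∞)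
    (hd : Pairwise (fun i j => Disjoint (B i) (B j))) : iIndepFun (fun i ω => M ω (B i)) P := by
  let e := Fintype.equivFin ι
  have h := hM.indep (Fintype.card ι) (fun i => B (e.symm i)) (fun i => hB _) (fun i => hμB _)
    (fun i j hij => hd (e.symm.injective.ne hij))
  have h2 := h.precomp e.injective
  simpa using h2

lemma measurable_pow_floor_toReal (c : ℂ) : Measurable (fun y : ℝ≥0∞ => c ^ ⌊y.toReal⌋₊) :=
  (measurable_from_nat (f := fun k => c ^ k)).comp
    (Nat.measurable_floor.comp ENNReal.measurable_toReal)

/-- The floor of `toReal` recovers the integer count from its value in `ℝ≥0∞`, so that c can be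
raised to it; the rest is the Poisson generating function. -/
lemma IsPoissonRandomMeasure.integral_pow (hM : IsPoissonRandomMeasure M μ P) {B : Set E}
    (hB : MeasurableSet B) (hμB : μ B ≠ ∞) (c : ℂ) :
    ∫ ω, c ^ ⌊(M ω B).toReal⌋₊ ∂P = exp (μ.real B * (c - 1)) := by
  have h := (hM.hasLaw B hB hμB).integral_comp (f := fun y => c ^ ⌊y.toReal⌋₊)
    (measurable_pow_floor_toReal c).aestronglyMeasurable
  rw [Function.comp_def] at h
  rw [h, integral_map .of_discrete (measurable_pow_floor_toReal c).aestronglyMeasurable]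
  simp only [ENNReal.toReal_natCast, Nat.floor_natCast]
  rw [integral_pow_poissonMeasure]
  rfl

/-- The factor contributed by the point of index `n` to the product of `f` over a point measure. -/
def pointFactor (used : ℕ → Ω → Bool) (x : ℕ → Ω → E) (f : E → ℂ) (n : ℕ) (ω : Ω) : ℂ :=
  if used n ω then f (x n ω) else 1

omit [MeasurableSpace Ω] [MeasurableSpace E] in
lemma norm_pointFactor_le (used : ℕ → Ω → Bool) (x : ℕ → Ω → E) {f : E → ℂ} (hf : ∀ y, ‖f y‖ ≤ 1)
    (n : ℕ) (ω : Ω) : ‖pointFactor used x f n ω‖ ≤ 1 := by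
  unfold pointFactor
  split_ifs
  · exact hf _
  · simp

lemma measurable_pointFactor {used : ℕ → Ω → Bool} {x : ℕ → Ω → E}
    (hused : ∀ n, Measurable (used n)) (hx : ∀ n, Measurable (x n)) {f : E → ℂ}
    (hf : Measurable f) (n : ℕ) : Measurable (pointFactor used x f n) :=
  Measurable.ite (hused n (measurableSet_singleton true)) (hf.comp (hx n)) measurable_const

omit [MeasurableSpace Ω] [MeasurableSpace E] in
lemma prod_range_pointFactor_eventually_eq {used : ℕ → Ω → Bool} {x : ℕ → Ω → E} {f : E → ℂ}
    {R : Set E} (hfR : ∀ y, y ∉ R → f y = 1) {ω : Ω} {S : Finset ℕ}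
    (hS : ∀ n, n ∈ S ↔ used n ω = true ∧ x n ω ∈ R) :
    ∀ᶠ m in atTop, ∏ n ∈ Finset.range m, pointFactor used x f n ω = ∏ n ∈ S, f (x n ω) := by
  filter_upwards [eventually_ge_atTop (S.sup id + 1)] with m hm
  have hsub : S ⊆ Finset.range m := fun n hn =>
    Finset.mem_range.2 ((Nat.lt_succ_of_le (Finset.le_sup (f := id) hn)).trans_le hm)
  rw [← Finset.prod_subset hsub]
  · refine Finset.prod_congr rfl fun n hn => ?_
    simp [pointFactor, ((hS n).1 hn).1]
  · intro n _ hn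
    have h := mt (hS n).2 hn
    unfold pointFactor
    split_ifs with hu
    · exact hfR _ fun hR => h ⟨hu, hR⟩
    · rfl

open Classical in
/-- The product of `f` over the finitely many points that lie in `R`. -/
noncomputable def pointProd (used : ℕ → Ω → Bool) (x : ℕ → Ω → E) (R : Set E) (f : E → ℂ) (ω : Ω) : ℂ :=
  if h : {n | used n ω = true ∧ x n ω ∈ R}.Finite then ∏ n ∈ h.toFinset, f (x n ω) else 1

omit [MeasurableSpace Ω] [MeasurableSpace E] in
lemma norm_pointProd_le (used : ℕ → Ω → Bool) (x : ℕ → Ω → E) (R : Set E) {f : E → ℂ}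
    (hf : ∀ y, ‖f y‖ ≤ 1) (ω : Ω) : ‖pointProd used x R f ω‖ ≤ 1 := by
  unfold pointProd
  split_ifs
  · exact norm_prod_le_one _ fun n => hf _
  · simp

variable {used : ℕ → Ω → Bool} {x : ℕ → Ω → E}

/-- Since f = 1 off R and R almost surely contains finitely many points, the partial products are
eventually constant. -/
lemma ae_tendsto_pointProd
    (hM : IsPoissonRandomMeasure (fun ω => pointMeasure (fun n => used n ω) (fun n => x n ω)) μ P)
    {R : Set E} (hR : MeasurableSet R) (hμR : μ R ≠ ∞) {f : E → ℂ} (hfR : ∀ y, y ∉ R → f y = 1) :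
    ∀ᵐ ω ∂P, Tendsto (fun m => ∏ n ∈ Finset.range m, pointFactor used x f n ω) atTop
      (𝓝 (pointProd used x R f ω)) := by
  filter_upwards [hM.ae_ne_top hR hμR] with ω hω
  have hfin := finite_of_pointMeasure_ne_top _ _ hR hω
  rw [pointProd, dif_pos hfin]
  exact tendsto_const_nhds.congr' <| EventuallyEq.symm <|
    prod_range_pointFactor_eventually_eq hfR fun n => by simp

/-- The level sets of f cut R into finitely many disjoint pieces with independent Poisson counts,
and the product over the points is the product of the values c raised to these counts. -/
lemma integral_pointProd_simpleFunc [IsProbabilityMeasure P]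
    (hM : IsPoissonRandomMeasure (fun ω => pointMeasure (fun n => used n ω) (fun n => x n ω)) μ P)
    {R : Set E} (hR : MeasurableSet R) (hμR : μ R ≠ ∞) (f : SimpleFunc E ℂ) :
    ∫ ω, pointProd used x R f ω ∂P = exp (∫ y in R, (f y - 1) ∂μ) := by
  set N : Ω → Measure E := fun ω => pointMeasure (fun n => used n ω) (fun n => x n ω) with hN
  let B : f.range → Set E := fun c => f ⁻¹' {(c : ℂ)} ∩ R
  have hB : ∀ c, MeasurableSet (B c) := fun c => (f.measurableSet_fiber _).inter hR
  have hμB : ∀ c, μ (B c) ≠ ∞ := fun c => measure_ne_top_of_subset Set.inter_subset_right hμR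
  have hd : Pairwise (fun c d => Disjoint (B c) (B d)) := by
    intro c d hcd
    rw [Set.disjoint_left]
    rintro y ⟨h1, -⟩ ⟨h2, -⟩
    exact hcd (Subtype.ext (h1.symm.trans h2))
  have h1 : ∀ᵐ ω ∂P, pointProd used x R f ω
      = ∏ c : f.range, (c : ℂ) ^ ⌊(N ω (B c)).toReal⌋₊ := by
    filter_upwards [hM.ae_ne_top hR hμR] with ω hω
    have hfin := finite_of_pointMeasure_ne_top _ _ hR hω
    rw [pointProd, dif_pos hfin, Finset.prod_coe_sort f.range
      (fun c => c ^ ⌊(N ω (f ⁻¹' {c} ∩ R)).toReal⌋₊), ← Finset.prod_fiberwise_of_maps_to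
      (t := f.range) (g := fun n => f (x n ω)) (fun n _ => f.mem_range_self _)]
    refine Finset.prod_congr rfl fun c _ => ?_
    have hcard : N ω (f ⁻¹' {c} ∩ R)
        = ((hfin.toFinset.filter (fun n => f (x n ω) = c)).card : ℝ≥0∞) := by
      refine pointMeasure_apply_eq_card _ _ ((f.measurableSet_fiber _).inter hR) _ fun n => ?_
      simp only [Finset.mem_filter, Set.Finite.mem_toFinset, Set.mem_ofPred_eq, Set.mem_inter_iff,
        Set.mem_preimage, Set.mem_singleton_iff]
      tauto
    rw [hcard, ENNReal.toReal_natCast, Nat.floor_natCast, ← Finset.prod_const]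
    exact Finset.prod_congr rfl fun n hn => (Finset.mem_filter.1 hn).2
  rw [integral_congr_ae h1, (hM.indep_fintype B hB hμB hd).integral_fun_prod_comp
    (f := fun (c : f.range) (y : ℝ≥0∞) => (c : ℂ) ^ ⌊y.toReal⌋₊)
    (fun c => (Measure.measurable_measure.1 hM.measurable _ (hB c)).aemeasurable)
    (fun c => (measurable_pow_floor_toReal _).aestronglyMeasurable)]
  simp_rw [fun c => hM.integral_pow (hB c) (hμB c) (c : ℂ)]
  rw [← exp_sum]
  congr 1
  have : IsFiniteMeasure (μ.restrict R) := ⟨by simpa using hμR.lt_top⟩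
  have hint : Integrable f (μ.restrict R) := SimpleFunc.integrable_of_isFiniteMeasure f
  have huniv : (μ.restrict R).real Set.univ
      = ∑ c ∈ f.range, (μ.restrict R).real (f ⁻¹' {c}) := by
    rw [sum_measureReal_preimage_singleton f.range fun c _ => f.measurableSet_fiber c]
    congr 1
    ext y
    simp
  rw [integral_sub hint (integrable_const 1), SimpleFunc.integral_eq_sum f hint, integral_const,
    huniv, Finset.sum_coe_sort f.range (fun c => (μ.real (f ⁻¹' {c} ∩ R) : ℂ) * (c - 1)),
    Finset.sum_smul, ← Finset.sum_sub_distrib]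
  refine Finset.sum_congr rfl fun c _ => ?_
  rw [measureReal_restrict_apply (f.measurableSet_fiber c), real_smul, real_smul, mul_sub]

theorem IsPoissonRandomMeasure.integral_pointProd [IsProbabilityMeasure P]
    (hM : IsPoissonRandomMeasure (fun ω => pointMeasure (fun n => used n ω) (fun n => x n ω)) μ P)
    (hused : ∀ n, Measurable (used n)) (hx : ∀ n, Measurable (x n))
    {R : Set E} (hR : MeasurableSet R) (hμR : μ R ≠ ∞) {f : E → ℂ} (hf : Measurable f)
    (hf1 : ∀ y, ‖f y‖ ≤ 1) (hfR : ∀ y, y ∉ R → f y = 1) :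
    ∫ ω, pointProd used x R f ω ∂P = exp (∫ y, (f y - 1) ∂μ) := by
  have hR0 : ∫ y, (f y - 1) ∂μ = ∫ y in R, (f y - 1) ∂μ :=
    (setIntegral_eq_integral_of_forall_compl_eq_zero fun y hy => by simp [hfR y hy]).symm
  rw [hR0]
  have hs := hf.stronglyMeasurable
  -- `approxBounded 1` keeps the norm at most 1, and the value 1 off R keeps the product restricted
  -- to the points of R.
  let g : ℕ → SimpleFunc E ℂ := fun j =>
    SimpleFunc.piecewise R hR (hs.approxBounded 1 j) (SimpleFunc.const E 1)
  have hg1 : ∀ j y, ‖g j y‖ ≤ 1 := by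
    intro j y
    simp only [g, SimpleFunc.coe_piecewise, Set.piecewise]
    split_ifs
    · exact hs.norm_approxBounded_le zero_le_one j y
    · simp
  have hgR : ∀ j y, y ∉ R → g j y = 1 := by
    intro j y hy
    simp [g, hy]
  have hglim : ∀ y, Tendsto (fun j => g j y) atTop (𝓝 (f y)) := by
    intro y
    by_cases hy : y ∈ R
    · simpa [g, hy] using hs.tendsto_approxBounded_of_norm_le (hf1 y)
    · simp [hgR _ y hy, hfR y hy]
  have hae : ∀ {h : E → ℂ}, Measurable h → (∀ y, y ∉ R → h y = 1) →
      AEStronglyMeasurable (pointProd used x R h) P := by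
    intro h hh hhR
    exact aestronglyMeasurable_of_tendsto_ae atTop (fun m => (Finset.measurable_prod _
      fun n _ => measurable_pointFactor hused hx hh n).aestronglyMeasurable)
      (ae_tendsto_pointProd hM hR hμR hhR)
  have h1 : Tendsto (fun j => ∫ ω, pointProd used x R (g j) ω ∂P) atTop
      (𝓝 (∫ ω, pointProd used x R f ω ∂P)) := by
    refine tendsto_integral_of_norm_le_one (fun j => hae (g j).measurable (hgR j))
      (fun j ω => norm_pointProd_le used x R (hg1 j) ω) (ae_of_all _ fun ω => ?_)
    unfold pointProd
    split_ifs
    · exact tendsto_finsetProd _ fun n _ => hglim _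
    · exact tendsto_const_nhds
  have : IsFiniteMeasure (μ.restrict R) := ⟨by simpa using hμR.lt_top⟩
  have h2 : Tendsto (fun j => ∫ y in R, (g j y - 1) ∂μ) atTop (𝓝 (∫ y in R, (f y - 1) ∂μ)) := by
    refine tendsto_integral_of_dominated_convergence (fun _ => 2)
      (fun j => ((g j).measurable.sub_const 1).aestronglyMeasurable) (integrable_const 2)
      (fun j => ae_of_all _ fun y => ?_) (ae_of_all _ fun y => (hglim y).sub_const 1)
    calc ‖g j y - 1‖ ≤ ‖g j y‖ + ‖(1 : ℂ)‖ := norm_sub_le _ _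
      _ ≤ 2 := by rw [norm_one]; linarith [hg1 j y]
  simp_rw [fun j => integral_pointProd_simpleFunc hM hR hμR (g j)] at h1
  exact tendsto_nhds_unique h1 ((continuous_exp.tendsto _).comp h2)

/-- The formula is given as a limit over finite index ranges because decorations are integrated out
of finite products only. -/
theorem IsPoissonRandomMeasure.tendsto_integral_prod_pointFactor [IsProbabilityMeasure P]
    (hM : IsPoissonRandomMeasure (fun ω => pointMeasure (fun n => used n ω) (fun n => x n ω)) μ P)
    (hused : ∀ n, Measurable (used n)) (hx : ∀ n, Measurable (x n))
    {R : Set E} (hR : MeasurableSet R) (hμR : μ R ≠ ∞) {f : E → ℂ} (hf : Measurable f)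
    (hf1 : ∀ y, ‖f y‖ ≤ 1) (hfR : ∀ y, y ∉ R → f y = 1) :
    Tendsto (fun m => ∫ ω, ∏ n ∈ Finset.range m, pointFactor used x f n ω ∂P) atTop
      (𝓝 (exp (∫ y, (f y - 1) ∂μ))) := by
  rw [← hM.integral_pointProd hused hx hR hμR hf hf1 hfR]
  exact tendsto_integral_of_norm_le_one (fun m => (Finset.measurable_prod _
    fun n _ => measurable_pointFactor hused hx hf n).aestronglyMeasurable)
    (fun m ω => norm_prod_le_one _ fun n => norm_pointFactor_le used x hf1 n ω)
    (ae_tendsto_pointProd hM hR hμR hfR)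

end PoissonFunctional

/-! ### Counts and characteristic function of a single cluster -/

section Clusters

/-- The number of points in `[0, s]` of the cluster `{u e^{T 0}, u e^{T 1}, …}`. -/
noncomputable def clusterCount (u s : ℝ≥0) (T : ℕ → ℝ) : ℝ≥0∞ :=
  ∑' k, if u * (Real.exp (T k)).toNNReal ≤ s then 1 else 0

lemma measurable_clusterCount (s : ℝ≥0) :
    Measurable (fun q : ℝ≥0 × (ℕ → ℝ) => clusterCount q.1 s q.2) := by
  refine Measurable.tsum fun k => Measurable.ite ?_ measurable_const measurable_const
  exact measurableSet_le (by fun_prop) measurable_const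

lemma toReal_clusterCount (u s : ℝ≥0) (T : ℕ → ℝ) :
    (clusterCount u s T).toReal = ({k | u * (Real.exp (T k)).toNNReal ≤ s}.ncard : ℝ) := by
  have h : clusterCount u s T = ({k | u * (Real.exp (T k)).toNNReal ≤ s}.encard : ℝ≥0∞) := by
    rw [← ENNReal.tsum_set_one, tsum_subtype _ (fun _ => (1 : ℝ≥0∞))]
    refine tsum_congr fun k => ?_
    simp [Set.indicator_apply]
  rw [h, Set.ncard]
  rcases Set.finite_or_infinite {k | u * (Real.exp (T k)).toNNReal ≤ s} with hf | hf
  · rw [← hf.cast_ncard_eq]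
    simp
  · simp [hf.encard_eq]

lemma mul_exp_toNNReal_le_iff (u s : ℝ≥0) (r : ℝ) :
    u * (Real.exp r).toNNReal ≤ s ↔ (u : ℝ) * Real.exp r ≤ s := by
  rw [← NNReal.coe_le_coe, NNReal.coe_mul, Real.coe_toNNReal _ (Real.exp_pos r).le]

lemma mul_exp_toNNReal_le_iff_log {u s : ℝ≥0} (hu : 0 < u) (hs : 0 < s) (r : ℝ) :
    u * (Real.exp r).toNNReal ≤ s ↔ r ≤ Real.log (s / u) := by
  have hu' : (0 : ℝ) < u := hu
  have hs' : (0 : ℝ) < s := hs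
  rw [mul_exp_toNNReal_le_iff, Real.le_log_iff_exp_le (by positivity), le_div_iff₀' hu']

/-- An ancestor at time 0 has all its infinitely many descendants at 0, hence the condition on u;
otherwise only birth times up to log(s / u) count. -/
lemma clusterCount_ne_top {u s : ℝ≥0} (hu : 0 < u) {T : ℕ → ℝ} (hT : IsBirthTimes T) :
    clusterCount u s T ≠ ∞ := by
  have hfin : {k | u * (Real.exp (T k)).toNNReal ≤ s}.Finite := by
    rcases eq_or_lt_of_le (zero_le (a := s)) with hs | hs
    · refine Set.finite_empty.subset fun k hk => ?_
      have hk : u * (Real.exp (T k)).toNNReal ≤ s := hk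
      rw [← hs] at hk
      have : 0 < u * (Real.exp (T k)).toNNReal :=
        mul_pos hu (Real.toNNReal_pos.2 (Real.exp_pos _))
      exact absurd hk (not_le.2 this)
    · refine (hT.finite (Real.log (s / u))).subset fun k hk => ?_
      exact (mul_exp_toNNReal_le_iff_log hu hs _).1 hk
  rw [clusterCount, tsum_eq_sum (s := hfin.toFinset)]
  · exact (ENNReal.sum_lt_top.2 fun k _ => by split_ifs <;> simp).ne
  · intro k hk
    simpa using hk

lemma clusterCount_eq_zero {u s : ℝ≥0} (hus : s < u) {T : ℕ → ℝ} (hT : IsBirthTimes T) :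
    clusterCount u s T = 0 := by
  rw [clusterCount, ENNReal.tsum_eq_zero]
  intro k
  rw [if_neg]
  rw [mul_exp_toNNReal_le_iff, not_le]
  have h1 : (s : ℝ) < u := hus
  have h2 := Real.one_le_exp (hT.nonneg k)
  nlinarith [NNReal.coe_nonneg s]

/-- With ancestor at u = tv, the inequality u exp(T_k / p) ≤ s reads T_k ≤ p (log(s / t) - log v),
the Yule-Simon condition. If v > s / t, the ancestor is already beyond s and both sides vanish. -/
lemma toReal_clusterCount_eq_yuleSimon {p v : ℝ} (hp : 0 < p) (hv : 0 < v) {t s : ℝ≥0}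
    (ht : 0 < t) (hs : 0 < s) {T : ℕ → ℝ} (hT : IsBirthTimes T) :
    (clusterCount (t * v).toNNReal s (fun n => T n / p)).toReal
      = yuleSimon p ((s : ℝ) / t) (v, T) := by
  have ht' : (0 : ℝ) < t := ht
  have hs' : (0 : ℝ) < s := hs
  have hu : 0 < (t * v).toNNReal := Real.toNNReal_pos.2 (by positivity)
  have hu' : (((t * v).toNNReal : ℝ≥0) : ℝ) = t * v := Real.coe_toNNReal _ (by positivity)
  unfold yuleSimon
  split_ifs with h
  · rw [toReal_clusterCount, yule]
    congr 2
    ext k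
    simp only [Set.mem_ofPred_eq]
    rw [mul_exp_toNNReal_le_iff_log hu hs, hu', div_le_iff₀' hp, ← div_div,
      Real.log_div (by positivity) (by positivity)]
  · rw [clusterCount_eq_zero _ (hT.div hp)]
    · simp
    · rw [← NNReal.coe_lt_coe, hu']
      rw [not_le] at h
      simp only at h
      rwa [div_lt_iff₀' ht'] at h

/-- The number of points in `[0, s] × A` of the cluster with ancestor `y` and birth times `T`. -/
noncomputable def markedCount (s : ℝ≥0) (A : Set ℝ) (q : (ℝ≥0 × ℝ) × (ℕ → ℝ)) : ℝ≥0∞ :=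
  A.indicator 1 q.1.2 * clusterCount q.1.1 s q.2

lemma measurable_markedCount (s : ℝ≥0) {A : Set ℝ} (hA : MeasurableSet A) :
    Measurable (markedCount s A) := by
  have h1 : Measurable (A.indicator (1 : ℝ → ℝ≥0∞)) := measurable_one.indicator hA
  have h2 := measurable_clusterCount s
  exact (h1.comp (by fun_prop)).mul
    (h2.comp (measurable_fst.fst.prodMk measurable_snd))

lemma decoratedMeasure_apply (used : ℕ → Bool) (x : ℕ → ℝ≥0 × ℝ) (T : ℕ → ℕ → ℝ) {B : Set (ℝ≥0 × ℝ)}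
    (hB : MeasurableSet B) :
    decoratedMeasure used x T B = ∑' n, if used n then
      ∑' k, B.indicator 1 ((x n).1 * (Real.exp (T n k)).toNNReal, (x n).2) else 0 := by
  rw [decoratedMeasure, Measure.sum_apply _ hB]
  refine tsum_congr fun n => ?_
  split_ifs with h
  · rw [Measure.sum_apply _ hB]
    exact tsum_congr fun k => Measure.dirac_apply' _ hB
  · simp

lemma decoratedMeasure_Icc_prod (used : ℕ → Bool) (x : ℕ → ℝ≥0 × ℝ) (T : ℕ → ℕ → ℝ) (s : ℝ≥0)
    {A : Set ℝ} (hA : MeasurableSet A) :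
    decoratedMeasure used x T (Set.Icc 0 s ×ˢ A)
      = ∑' n, if used n then markedCount s A (x n, T n) else 0 := by
  rw [decoratedMeasure_apply _ _ _ (measurableSet_Icc.prod hA)]
  refine tsum_congr fun n => ?_
  split_ifs with h
  · rw [markedCount, clusterCount, ← ENNReal.tsum_mul_left]
    refine tsum_congr fun k => ?_
    by_cases h1 : (x n).2 ∈ A <;> by_cases h2 : (x n).1 * (Real.exp (T n k)).toNNReal ≤ s <;>
      simp [h1, h2]
  · rfl

/-- The joint characteristic function of the numbers of points in `[0, s a] × A a` of a cluster
with ancestor `y`. -/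
noncomputable def clusterTransform {ι : Type*} [Fintype ι] (p : ℝ) (s : ι → ℝ≥0) (A : ι → Set ℝ)
    (l : ι → ℝ) (y : ℝ≥0 × ℝ) : ℂ :=
  ∫ T, exp (I * ((∑ a, l a * (markedCount (s a) (A a) (y, T)).toReal : ℝ) : ℂ)) ∂birthTimesLaw p

variable {ι : Type*} [Fintype ι]

lemma measurable_exp_markedCount (s : ι → ℝ≥0) {A : ι → Set ℝ} (hA : ∀ a, MeasurableSet (A a))
    (l : ι → ℝ) : Measurable (fun q : (ℝ≥0 × ℝ) × (ℕ → ℝ) =>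
      exp (I * ((∑ a, l a * (markedCount (s a) (A a) q).toReal : ℝ) : ℂ))) := by
  have := fun a => (measurable_markedCount (s a) (hA a)).ennreal_toReal
  fun_prop

lemma measurable_clusterTransform {p : ℝ} (hp : 0 < p) (s : ι → ℝ≥0) {A : ι → Set ℝ}
    (hA : ∀ a, MeasurableSet (A a)) (l : ι → ℝ) : Measurable (clusterTransform p s A l) := by
  have := isProbabilityMeasure_birthTimesLaw hp
  exact (measurable_exp_markedCount s hA l).stronglyMeasurable.integral_prod_right'.measurable

lemma norm_clusterTransform_le {p : ℝ} (hp : 0 < p) (s : ι → ℝ≥0) (A : ι → Set ℝ)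
    (l : ι → ℝ) (y : ℝ≥0 × ℝ) : ‖clusterTransform p s A l y‖ ≤ 1 := by
  have := isProbabilityMeasure_birthTimesLaw hp
  refine (norm_integral_le_of_norm_le_const (ae_of_all _ fun T => (norm_exp_I_mul _).le)).trans ?_
  simp

/-- Birth times are nonnegative, so a cluster never has points before its ancestor, nor with another
mark. -/
lemma clusterTransform_eq_one {p : ℝ} (hp : 0 < p) (s : ι → ℝ≥0) (A : ι → Set ℝ)
    (l : ι → ℝ) (y : ℝ≥0 × ℝ) (h : ∀ a, s a < y.1 ∨ y.2 ∉ A a) :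
    clusterTransform p s A l y = 1 := by
  have := isProbabilityMeasure_birthTimesLaw hp
  have h1 : (fun T => exp (I * ((∑ a, l a * (markedCount (s a) (A a) (y, T)).toReal : ℝ) : ℂ)))
      =ᵐ[birthTimesLaw p] fun _ => 1 := by
    filter_upwards [ae_isBirthTimes hp] with T hT
    rw [Finset.sum_eq_zero]
    · simp
    · intro a _
      rcases h a with h | h
      · simp [markedCount, clusterCount_eq_zero h hT]
      · simp [markedCount, h]
  rw [clusterTransform, integral_congr_ae h1]
  simp

end Clusters

/-! ### Averaging over the decorations -/

section Decoration

variable {Ω : Type*} [MeasurableSpace Ω] {P : Measure Ω} {ν : Measure ℝ} {p : ℝ}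
  {used : ℕ → Ω → Bool} {x : ℕ → Ω → ℝ≥0 × ℝ} {T : ℕ → Ω → ℕ → ℝ}

/-- The ancestors are independent of the decorations, so Fubini freezes the ancestors; the
decorations are i.i.d., so the inner integral of the product is a product of averages. -/
lemma IsPoissonWithDecorations.integral_prod_pointFactor [IsProbabilityMeasure P]
    (h : IsPoissonWithDecorations ν p used x T P)
    {g : (ℝ≥0 × ℝ) × (ℕ → ℝ) → ℂ} (hg : Measurable g) (hg1 : ∀ q, ‖g q‖ ≤ 1) (m : ℕ) :
    ∫ ω, ∏ n ∈ Finset.range m, pointFactor used (fun n ω => (x n ω, T n ω)) g n ω ∂P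
      = ∫ ω, ∏ n ∈ Finset.range m,
          pointFactor used x (fun y => ∫ t, g (y, t) ∂birthTimesLaw p) n ω ∂P := by
  let φ : Bool × (ℝ≥0 × ℝ) → (ℕ → ℝ) → ℂ := fun z t => if z.1 then g (z.2, t) else 1
  -- The flag marking an index as used is kept with the ancestor: it may depend on the other
  -- ancestors but not on the decorations.
  have hφ : Measurable (fun q : (Bool × (ℝ≥0 × ℝ)) × (ℕ → ℝ) => φ q.1 q.2) :=
    Measurable.ite (measurable_fst.fst (measurableSet_singleton true))
      (hg.comp (measurable_fst.snd.prodMk measurable_snd)) measurable_const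
  have hφz : ∀ z, Measurable (φ z) := fun z => hφ.comp (measurable_prodMk_left (x := z))
  have hφ1 : ∀ z t, ‖φ z t‖ ≤ 1 := by
    intro z t
    simp only [φ]
    split_ifs
    · exact hg1 _
    · simp
  let Z : Ω → ℕ → Bool × (ℝ≥0 × ℝ) := fun ω n => (used n ω, x n ω)
  let W : Ω → ℕ → ℕ → ℝ := fun ω n => T n ω
  have hZ : Measurable Z := measurable_pi_lambda _ fun n =>
    (h.measurable_used n).prodMk (h.measurable_point n)
  have hW : Measurable W := measurable_pi_lambda _ h.measurable_times
  have hlaw : P.map (fun ω => (Z ω, W ω)) = (P.map Z).prod (P.map W) :=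
    (indepFun_iff_map_prod_eq_prod_map_map hZ.aemeasurable hW.aemeasurable).1 h.indep_points_times
  have := Measure.isProbabilityMeasure_map hZ.aemeasurable (μ := P)
  have := Measure.isProbabilityMeasure_map hW.aemeasurable (μ := P)
  let G : (ℕ → Bool × (ℝ≥0 × ℝ)) × (ℕ → ℕ → ℝ) → ℂ := fun q =>
    ∏ n ∈ Finset.range m, φ (q.1 n) (q.2 n)
  have hG : Measurable G := Finset.measurable_prod _ fun n _ => by
    have h1 : Measurable (fun q : (ℕ → Bool × (ℝ≥0 × ℝ)) × (ℕ → ℕ → ℝ) => (q.1 n, q.2 n)) := by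
      fun_prop
    exact hφ.comp h1
  have hG1 : ∀ q, ‖G q‖ ≤ 1 := fun q => norm_prod_le_one _ fun n => hφ1 _ _
  have hinner : ∀ z : ℕ → Bool × (ℝ≥0 × ℝ), ∫ w, G (z, w) ∂P.map W
      = ∏ n ∈ Finset.range m,
        if (z n).1 then ∫ t, g ((z n).2, t) ∂birthTimesLaw p else 1 := by
    intro z
    have hGz : Measurable (fun w => G (z, w)) := hG.comp measurable_prodMk_left
    rw [integral_map hW.aemeasurable hGz.aestronglyMeasurable]
    have h1 := (h.indep_times.restrict (Finset.range m)).integral_fun_prod_comp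
      (f := fun (n : Finset.range m) t => φ (z n) t)
      (fun n => (h.measurable_times n).aemeasurable)
      (fun n => (hφz _).aestronglyMeasurable)
    simp only [Finset.restrict] at h1
    rw [Finset.prod_coe_sort (Finset.range m) (fun n => ∫ ω, φ (z n) (T n ω) ∂P)] at h1
    have h2 : ∀ ω, G (z, W ω) = ∏ n : Finset.range m, φ (z n) (T n ω) := fun ω =>
      (Finset.prod_coe_sort (Finset.range m) (fun n => φ (z n) (T n ω))).symm
    simp_rw [h2, h1]
    refine Finset.prod_congr rfl fun n _ => ?_
    have h3 := (h.law_times n).integral_comp (f := φ (z n)) (hφz _).aestronglyMeasurable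
    rw [Function.comp_def] at h3
    rw [h3]
    have := (h.law_times n).isProbabilityMeasure_iff.1 inferInstance
    simp only [φ]
    split_ifs <;> simp
  calc ∫ ω, ∏ n ∈ Finset.range m, pointFactor used (fun n ω => (x n ω, T n ω)) g n ω ∂P
      = ∫ q, G q ∂P.map (fun ω => (Z ω, W ω)) :=
        (integral_map (hZ.prodMk hW).aemeasurable hG.aestronglyMeasurable).symm
    _ = ∫ z, ∫ w, G (z, w) ∂P.map W ∂P.map Z := by
        rw [hlaw, integral_prod _ (integrable_of_norm_le_one hG.aestronglyMeasurable hG1)]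
    _ = _ := by
        rw [integral_map hZ.aemeasurable
          hG.stronglyMeasurable.integral_prod_right'.aestronglyMeasurable]
        simp_rw [hinner]
        rfl

end Decoration

/-! ### The intensity of the ancestors -/

section Intensity

instance : SFinite lebesgueNNReal := by
  unfold lebesgueNNReal
  infer_instance

lemma lebesgueNNReal_Icc (t : ℝ≥0) : lebesgueNNReal (Set.Icc 0 t) = t := by
  rw [lebesgueNNReal, Measure.map_apply (by fun_prop) measurableSet_Icc,
    Measure.restrict_apply (measurableSet_Icc.preimage (by fun_prop))]
  have : Real.toNNReal ⁻¹' Set.Icc 0 t ∩ Set.Ici 0 = Set.Icc 0 (t : ℝ) := by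
    ext r
    simp only [Set.mem_inter_iff, Set.mem_preimage, Set.mem_Icc, zero_le, true_and, Set.mem_Ici,
      Real.toNNReal_le_iff_le_coe]
    tauto
  rw [this, Real.volume_Icc, sub_zero, ENNReal.ofReal_coe_nnreal]

lemma lebesgueNNReal_singleton_zero : lebesgueNNReal {0} = 0 := by
  have := lebesgueNNReal_Icc 0
  simpa using this

/-- The intensity `(1 - p) dt ⊗ ν`. -/
noncomputable abbrev ancestorIntensity (p : ℝ) (ν : Measure ℝ) : Measure (ℝ≥0 × ℝ) :=
  ENNReal.ofReal (1 - p) • lebesgueNNReal.prod ν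

lemma ancestorIntensity_Icc_prod (p : ℝ) (ν : Measure ℝ) [SFinite ν] (t : ℝ≥0) (A : Set ℝ) :
    ancestorIntensity p ν (Set.Icc 0 t ×ˢ A) = ENNReal.ofReal (1 - p) * (t * ν A) := by
  rw [Measure.smul_apply, Measure.prod_prod, lebesgueNNReal_Icc, smul_eq_mul]

lemma ancestorIntensity_Icc_prod_ne_top (p : ℝ) (ν : Measure ℝ) [SFinite ν] (t : ℝ≥0) {A : Set ℝ}
    (hA : ν A ≠ ∞) : ancestorIntensity p ν (Set.Icc 0 t ×ˢ A) ≠ ∞ := by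
  rw [ancestorIntensity_Icc_prod]
  exact ENNReal.mul_ne_top ENNReal.ofReal_ne_top (ENNReal.mul_ne_top ENNReal.coe_ne_top hA)

lemma ancestorIntensity_zero_prod (p : ℝ) (ν : Measure ℝ) [SFinite ν] :
    ancestorIntensity p ν ({0} ×ˢ Set.univ) = 0 := by
  rw [Measure.smul_apply, Measure.prod_prod, lebesgueNNReal_singleton_zero, zero_mul, smul_zero]

lemma ancestorIntensity_eq_sum (p : ℝ) (ν : Measure ℝ) [SFinite ν] {A : ℕ → Set ℝ}
    (hA : ∀ j, MeasurableSet (A j)) (hd : Pairwise (fun i j => Disjoint (A i) (A j)))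
    (hU : (⋃ j, A j) = Set.univ) :
    ancestorIntensity p ν = Measure.sum (fun j => ancestorIntensity p (ν.restrict (A j))) := by
  have h1 : ν = Measure.sum (fun j => ν.restrict (A j)) := by
    rw [← Measure.restrict_iUnion hd hA, hU, Measure.restrict_univ]
  conv_lhs => rw [h1]
  ext B hB
  rw [ancestorIntensity, Measure.prod_sum_right, Measure.smul_apply, Measure.sum_apply _ hB, Measure.sum_apply _ hB,
    smul_eq_mul, ← ENNReal.tsum_mul_left]
  rfl

end Intensity

/-! ### Finiteness and characteristic function of the superposition -/

section Superposition

lemma decoratedMeasure_Icc_prod_ne_top {used : ℕ → Bool} {x : ℕ → ℝ≥0 × ℝ} {T : ℕ → ℕ → ℝ}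
    (hT : ∀ n, IsBirthTimes (T n)) (h0 : pointMeasure used x ({0} ×ˢ Set.univ) = 0) {t : ℝ≥0}
    {A : Set ℝ} (hA : MeasurableSet A) (ht : pointMeasure used x (Set.Icc 0 t ×ˢ A) ≠ ∞) :
    decoratedMeasure used x T (Set.Icc 0 t ×ˢ A) ≠ ∞ := by
  have hm : MeasurableSet (Set.Icc 0 t ×ˢ A) := measurableSet_Icc.prod hA
  have hfin := finite_of_pointMeasure_ne_top _ _ hm ht
  rw [decoratedMeasure_Icc_prod _ _ _ _ hA, tsum_eq_sum (s := hfin.toFinset)]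
  · refine (ENNReal.sum_lt_top.2 fun n _ => ?_).ne
    split_ifs with hu
    · refine (ENNReal.mul_ne_top (by by_cases h : (x n).2 ∈ A <;> simp [h]) ?_).lt_top
      refine clusterCount_ne_top (pos_iff_ne_zero.2 fun hx0 => ?_) (hT n)
      rw [pointMeasure_apply _ _ ((measurableSet_singleton 0).prod MeasurableSet.univ),
        ENNReal.tsum_eq_zero] at h0
      have := h0 n
      simp only at hx0
      simp [hu, hx0] at this
    · simp
  · intro n hn
    have hn' : ¬ (used n = true ∧ x n ∈ Set.Icc 0 t ×ˢ A) := by simpa using hn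
    split_ifs with hu
    · rw [markedCount]
      by_cases h2 : (x n).2 ∈ A
      · rw [clusterCount_eq_zero _ (hT n), mul_zero]
        by_contra hlt
        exact hn' ⟨hu, ⟨zero_le, not_lt.1 hlt⟩, h2⟩
      · simp [h2]
    · rfl

/-- A point measure of mass less than 1 has no point, and without an ancestor in [0, t] × A no
cluster reaches that rectangle. -/
lemma decoratedMeasure_Icc_prod_eq_zero {used : ℕ → Bool} {x : ℕ → ℝ≥0 × ℝ} {T : ℕ → ℕ → ℝ}
    (hT : ∀ n, IsBirthTimes (T n)) {t : ℝ≥0} {A : Set ℝ} (hA : MeasurableSet A)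
    (ht : pointMeasure used x (Set.Icc 0 t ×ˢ A) < 1) :
    decoratedMeasure used x T (Set.Icc 0 t ×ˢ A) = 0 := by
  have hm : MeasurableSet (Set.Icc 0 t ×ˢ A) := measurableSet_Icc.prod hA
  rw [decoratedMeasure_Icc_prod _ _ _ _ hA, ENNReal.tsum_eq_zero]
  intro n
  split_ifs with hu
  · rw [pointMeasure_apply _ _ hm] at ht
    have h1 := (ENNReal.le_tsum n).trans_lt ht
    rw [if_pos hu] at h1
    have h2 : x n ∉ Set.Icc 0 t ×ˢ A := fun hx => by simp [hx] at h1
    rw [markedCount]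
    by_cases h3 : (x n).2 ∈ A
    · rw [clusterCount_eq_zero _ (hT n), mul_zero]
      by_contra hlt
      exact h2 ⟨⟨zero_le, not_lt.1 hlt⟩, h3⟩
    · simp [h3]
  · rfl

/-- Measurability in the ingredients themselves lets independence of the blocks pass to the
decorated measures. -/
lemma measurable_decoratedMeasure :
    Measurable (fun b : ℕ → Bool × (ℝ≥0 × ℝ) × (ℕ → ℝ) =>
      decoratedMeasure (fun n => (b n).1) (fun n => (b n).2.1) (fun n => (b n).2.2)) := by
  refine Measure.measurable_of_measurable_coe _ fun B hB => ?_
  simp_rw [decoratedMeasure_apply _ _ _ hB]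
  refine Measurable.tsum fun n => Measurable.ite ?_ (Measurable.tsum fun k => ?_) measurable_const
  · exact (measurable_pi_apply n).fst (measurableSet_singleton true)
  · exact (measurable_one.indicator hB).comp (by fun_prop)

variable {Ω : Type*} [MeasurableSpace Ω] {P : Measure Ω}

/-- The exponential of the total count is the limit of products with one factor per cluster.
Averaging the decorations turns each factor into `clusterTransform` at the ancestor, and the
exponential formula gives the limit. -/
lemma IsPoissonWithDecorations.integral_exp [IsProbabilityMeasure P] {ν : Measure ℝ}
    [IsFiniteMeasure ν] {p : ℝ} (hp : 0 < p)
    {used : ℕ → Ω → Bool} {x : ℕ → Ω → ℝ≥0 × ℝ} {T : ℕ → Ω → ℕ → ℝ}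
    (h : IsPoissonWithDecorations ν p used x T P) {ι : Type*} [Fintype ι] (s : ι → ℝ≥0)
    {A : ι → Set ℝ} (hA : ∀ a, MeasurableSet (A a)) (l : ι → ℝ)
    (hfin : ∀ a, ∀ᵐ ω ∂P, decoratedMeasure (fun n => used n ω) (fun n => x n ω) (fun n => T n ω)
      (Set.Icc 0 (s a) ×ˢ A a) ≠ ∞) :
    ∫ ω, exp (I * ((∑ a, l a * (decoratedMeasure (fun n => used n ω) (fun n => x n ω)
      (fun n => T n ω) (Set.Icc 0 (s a) ×ˢ A a)).toReal : ℝ) : ℂ)) ∂P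
      = exp (∫ y, (clusterTransform p s A l y - 1) ∂ancestorIntensity p ν) := by
  set g : (ℝ≥0 × ℝ) × (ℕ → ℝ) → ℂ := fun q =>
    exp (I * ((∑ a, l a * (markedCount (s a) (A a) q).toReal : ℝ) : ℂ)) with hgdef
  have hg : Measurable g := measurable_exp_markedCount s hA l
  have hg1 : ∀ q, ‖g q‖ ≤ 1 := fun q => (norm_exp_I_mul _).le
  have hpt : ∀ n, Measurable (fun ω => (x n ω, T n ω)) := fun n =>
    (h.measurable_point n).prodMk (h.measurable_times n)
  have h1 : Tendsto (fun m => ∫ ω, ∏ n ∈ Finset.range m,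
      pointFactor used (fun n ω => (x n ω, T n ω)) g n ω ∂P) atTop
      (𝓝 (∫ ω, exp (I * ((∑ a, l a * (decoratedMeasure (fun n => used n ω) (fun n => x n ω)
      (fun n => T n ω) (Set.Icc 0 (s a) ×ˢ A a)).toReal : ℝ) : ℂ)) ∂P)) := by
    refine tendsto_integral_of_norm_le_one (fun m => (Finset.measurable_prod _ fun n _ =>
      measurable_pointFactor h.measurable_used hpt hg n).aestronglyMeasurable)
      (fun m ω => norm_prod_le_one _ fun n => norm_pointFactor_le _ _ hg1 n ω) ?_
    filter_upwards [ae_all_iff.2 hfin] with ω hω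
    let w : ι → ℕ → ℝ≥0∞ := fun a n =>
      if used n ω then markedCount (s a) (A a) (x n ω, T n ω) else 0
    have hw : ∀ a, decoratedMeasure (fun n => used n ω) (fun n => x n ω) (fun n => T n ω)
        (Set.Icc 0 (s a) ×ˢ A a) = ∑' n, w a n := fun a =>
      decoratedMeasure_Icc_prod _ _ _ _ (hA a)
    have hsum : ∀ a, Tendsto (fun m => ∑ n ∈ Finset.range m, (w a n).toReal) atTop
        (𝓝 (decoratedMeasure (fun n => used n ω) (fun n => x n ω) (fun n => T n ω)
        (Set.Icc 0 (s a) ×ˢ A a)).toReal) := by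
      intro a
      have h2 := hω a
      rw [hw a] at h2 ⊢
      rw [ENNReal.tsum_toReal_eq (ENNReal.ne_top_of_tsum_ne_top h2)]
      exact (ENNReal.summable_toReal h2).hasSum.tendsto_sum_nat
    have hprod : ∀ m, ∏ n ∈ Finset.range m, pointFactor used (fun n ω => (x n ω, T n ω)) g n ω
        = exp (I * ((∑ a, l a * ∑ n ∈ Finset.range m, (w a n).toReal : ℝ) : ℂ)) := by
      intro m
      have h3 : ∀ n, pointFactor used (fun n ω => (x n ω, T n ω)) g n ω
          = exp (I * ((∑ a, l a * (w a n).toReal : ℝ) : ℂ)) := by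
        intro n
        by_cases hu : used n ω = true <;> simp [pointFactor, hgdef, w, hu]
      simp_rw [h3]
      rw [← exp_sum, ← Finset.mul_sum, ← ofReal_sum, Finset.sum_comm]
      simp_rw [Finset.mul_sum]
    simp_rw [hprod]
    have hc : Continuous (fun r : ℝ => exp (I * (r : ℂ))) := by fun_prop
    exact (hc.tendsto _).comp (tendsto_finsetSum _ fun a _ => (hsum a).const_mul (l a))
  simp_rw [fun m => h.integral_prod_pointFactor hg hg1 m] at h1
  -- Ancestors later than every s a contribute the factor 1; the remaining strip has finite
  -- intensity since ν is finite.
  refine tendsto_nhds_unique h1 (h.poisson.tendsto_integral_prod_pointFactor h.measurable_used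
    h.measurable_point (R := Set.Icc 0 (Finset.univ.sup s) ×ˢ Set.univ)
    (measurableSet_Icc.prod MeasurableSet.univ)
    (ancestorIntensity_Icc_prod_ne_top p ν _ (measure_ne_top ν _))
    (measurable_clusterTransform hp s hA l) (norm_clusterTransform_le hp s A l) fun y hy => ?_)
  refine clusterTransform_eq_one hp s A l y fun a => Or.inl ?_
  by_contra hlt
  exact hy ⟨⟨zero_le, (not_lt.1 hlt).trans (Finset.le_sup (Finset.mem_univ a))⟩, trivial⟩

/-- The integrand is bounded by 2 and vanishes unless the ancestor lies in a rectangle of finite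
intensity. -/
lemma integrable_clusterTransform_sub_one (Λ : Measure ℝ) [SigmaFinite Λ] {p : ℝ} (hp : 0 < p)
    {ι : Type*} [Fintype ι] (s : ι → ℝ≥0) {B : ι → Set ℝ} (hB : ∀ a, MeasurableSet (B a))
    (hΛB : ∀ a, Λ (B a) ≠ ∞) (l : ι → ℝ) :
    Integrable (fun y => clusterTransform p s B l y - 1) (ancestorIntensity p Λ) := by
  let R : Set (ℝ≥0 × ℝ) := Set.Icc 0 (Finset.univ.sup s) ×ˢ ⋃ a, B a
  have hR : MeasurableSet R := measurableSet_Icc.prod (MeasurableSet.iUnion hB)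
  have hμR : ancestorIntensity p Λ R ≠ ∞ := by
    refine ancestorIntensity_Icc_prod_ne_top p Λ _ ?_
    refine ((measure_iUnion_fintype_le Λ B).trans_lt ?_).ne
    exact ENNReal.sum_lt_top.2 fun a _ => (hΛB a).lt_top
  have hon : IntegrableOn (fun y => clusterTransform p s B l y - 1) R
      (ancestorIntensity p Λ) := by
    refine Measure.integrableOn_of_bounded hμR
      ((measurable_clusterTransform hp s hB l).sub_const 1).aestronglyMeasurable (M := 2)
      (ae_of_all _ fun y => ?_)
    calc ‖clusterTransform p s B l y - 1‖ ≤ ‖clusterTransform p s B l y‖ + ‖(1 : ℂ)‖ :=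
          norm_sub_le _ _
      _ ≤ 2 := by rw [norm_one]; linarith [norm_clusterTransform_le hp s B l y]
  refine (integrableOn_iff_integrable_of_support_subset fun y hy => ?_).1 hon
  by_contra hyR
  refine hy (sub_eq_zero.2 (clusterTransform_eq_one hp s B l y fun a => ?_))
  by_contra hcon
  simp only [not_or, not_lt, not_not] at hcon
  exact hyR ⟨⟨zero_le, hcon.1.trans (Finset.le_sup (Finset.mem_univ a))⟩,
    Set.mem_iUnion.2 ⟨a, hcon.2⟩⟩

/-- The ingredients of a noise reinforced Poisson point process with characteristic measure `Λ`,
built from a partition of the line into sets of finite measure. -/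
structure IsReinforcedConstruction (Λ : Measure ℝ) (p : ℝ) (A : ℕ → Set ℝ)
    (used : ℕ → ℕ → Ω → Bool) (x : ℕ → ℕ → Ω → ℝ≥0 × ℝ) (T : ℕ → ℕ → Ω → ℕ → ℝ)
    (P : Measure Ω) : Prop where
  measurableSet : ∀ j, MeasurableSet (A j)
  disjoint : Pairwise (fun i j => Disjoint (A i) (A j))
  iUnion_eq : (⋃ j, A j) = Set.univ
  measure_lt_top : ∀ j, Λ (A j) < ∞
  decorations : ∀ j, IsPoissonWithDecorations (Λ.restrict (A j)) p (used j) (x j) (T j) P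
  indep : iIndepFun (fun j ω n => (used j n ω, x j n ω, T j n ω)) P

/-- The superposition of the decorated Poisson measures. -/
noncomputable def superposition (used : ℕ → ℕ → Ω → Bool) (x : ℕ → ℕ → Ω → ℝ≥0 × ℝ)
    (T : ℕ → ℕ → Ω → ℕ → ℝ) (ω : Ω) : Measure (ℝ≥0 × ℝ) :=
  Measure.sum (fun j =>
    decoratedMeasure (fun n => used j n ω) (fun n => x j n ω) (fun n => T j n ω))

namespace IsReinforcedConstruction

variable {Λ : Measure ℝ} {p : ℝ} {A : ℕ → Set ℝ} {used : ℕ → ℕ → Ω → Bool}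
  {x : ℕ → ℕ → Ω → ℝ≥0 × ℝ} {T : ℕ → ℕ → Ω → ℕ → ℝ}

lemma measurable_block (h : IsReinforcedConstruction Λ p A used x T P) (j : ℕ) :
    Measurable (fun ω n => (used j n ω, x j n ω, T j n ω)) :=
  measurable_pi_lambda _ fun n => ((h.decorations j).measurable_used n).prodMk
    (((h.decorations j).measurable_point n).prodMk ((h.decorations j).measurable_times n))

lemma measurable_decorated (h : IsReinforcedConstruction Λ p A used x T P) (j : ℕ) :
    Measurable (fun ω =>
      decoratedMeasure (fun n => used j n ω) (fun n => x j n ω) (fun n => T j n ω)) :=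
  Measurable.comp (g := fun b : ℕ → Bool × (ℝ≥0 × ℝ) × (ℕ → ℝ) =>
    decoratedMeasure (fun n => (b n).1) (fun n => (b n).2.1) (fun n => (b n).2.2))
    (f := fun ω n => (used j n ω, x j n ω, T j n ω))
    measurable_decoratedMeasure (h.measurable_block j)

lemma measurable_superposition (h : IsReinforcedConstruction Λ p A used x T P) :
    Measurable (superposition used x T) := by
  refine Measure.measurable_of_measurable_coe _ fun B hB => ?_
  simp_rw [superposition, Measure.sum_apply _ hB]
  exact Measurable.tsum fun j => Measure.measurable_measure.1 (h.measurable_decorated j) B hB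

lemma ae_isBirthTimes (h : IsReinforcedConstruction Λ p A used x T P) (hp : 0 < p) :
    ∀ᵐ ω ∂P, ∀ j n, IsBirthTimes (T j n ω) := by
  simp_rw [ae_all_iff]
  intro j n
  have h1 := NoiseReinforced.ae_isBirthTimes hp
  rw [← ((h.decorations j).law_times n).map_eq] at h1
  exact ae_of_ae_map ((h.decorations j).law_times n).aemeasurable h1

/-- The expected number of ancestors in [0, t] × B over all blocks is finite, so almost surely only
finitely many blocks have one there; each such block contributes a finite count, and the others
contribute nothing. -/
lemma ae_superposition_ne_top [SigmaFinite Λ] (h : IsReinforcedConstruction Λ p A used x T P)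
    (hp : 0 < p) (t : ℝ≥0) {B : Set ℝ} (hB : MeasurableSet B) (hΛB : Λ B ≠ ∞) :
    ∀ᵐ ω ∂P, superposition used x T ω (Set.Icc 0 t ×ˢ B) ≠ ∞ := by
  have hm : MeasurableSet (Set.Icc 0 t ×ˢ B) := measurableSet_Icc.prod hB
  have hm0 : MeasurableSet (({0} : Set ℝ≥0) ×ˢ (Set.univ : Set ℝ)) :=
    (measurableSet_singleton 0).prod MeasurableSet.univ
  have hfinB : ∀ j, (Λ.restrict (A j)) B ≠ ∞ := fun j =>
    ((Measure.restrict_apply_le _ _).trans_lt hΛB.lt_top).ne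
  let M : ℕ → Ω → Measure (ℝ≥0 × ℝ) := fun j ω =>
    pointMeasure (fun n => used j n ω) (fun n => x j n ω)
  have hMm : ∀ j, Measurable (M j) := fun j => (h.decorations j).poisson.measurable
  -- No ancestor sits at time 0, where a cluster would have infinitely many points.
  have h0 : ∀ᵐ ω ∂P, ∀ j, M j ω ({0} ×ˢ Set.univ) = 0 := by
    rw [ae_all_iff]
    intro j
    have h1 := (h.decorations j).poisson.lintegral_apply hm0
      (by rw [ancestorIntensity_zero_prod]; simp)
    rw [ancestorIntensity_zero_prod,
      lintegral_eq_zero_iff (Measure.measurable_measure.1 (hMm j) _ hm0)] at h1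
    exact h1
  have hsum : ∀ᵐ ω ∂P, ∑' j, M j ω (Set.Icc 0 t ×ˢ B) ≠ ∞ := by
    have hmeas : ∀ j, Measurable (fun ω => M j ω (Set.Icc 0 t ×ˢ B)) := fun j =>
      Measure.measurable_measure.1 (hMm j) _ hm
    have h2 : ∫⁻ ω, ∑' j, M j ω (Set.Icc 0 t ×ˢ B) ∂P
        = ancestorIntensity p Λ (Set.Icc 0 t ×ˢ B) := by
      rw [lintegral_tsum fun j => (hmeas j).aemeasurable,
        ancestorIntensity_eq_sum p Λ h.measurableSet h.disjoint h.iUnion_eq,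
        Measure.sum_apply _ hm]
      exact tsum_congr fun j => (h.decorations j).poisson.lintegral_apply hm
        (ancestorIntensity_Icc_prod_ne_top p _ t (hfinB j))
    filter_upwards [ae_lt_top (Measurable.tsum hmeas)
      (by rw [h2]; exact ancestorIntensity_Icc_prod_ne_top p _ t hΛB)] with ω hω using hω.ne
  filter_upwards [h0, hsum, h.ae_isBirthTimes hp] with ω h1 h2 h3
  have hfin := ENNReal.finite_const_le_of_tsum_ne_top h2 one_ne_zero
  rw [superposition, Measure.sum_apply _ hm, tsum_eq_sum (s := hfin.toFinset)]
  · exact (ENNReal.sum_lt_top.2 fun j _ => (decoratedMeasure_Icc_prod_ne_top (h3 j) (h1 j) hB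
      (ENNReal.ne_top_of_tsum_ne_top h2 j)).lt_top).ne
  · intro j hj
    refine decoratedMeasure_Icc_prod_eq_zero (h3 j) hB ?_
    simpa using hj

/-- The intensity is the sum of the block intensities, so the exponents of the independent blocks
sum to the integral over the whole line, integrability providing the convergence. -/
theorem integral_exp [IsProbabilityMeasure P] [SigmaFinite Λ]
    (h : IsReinforcedConstruction Λ p A used x T P) (hp : 0 < p) {ι : Type*} [Fintype ι]
    (s : ι → ℝ≥0) {B : ι → Set ℝ} (hB : ∀ a, MeasurableSet (B a)) (hΛB : ∀ a, Λ (B a) ≠ ∞)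
    (l : ι → ℝ) :
    ∫ ω, exp (I * ((∑ a, l a * (superposition used x T ω
      (Set.Icc 0 (s a) ×ˢ B a)).toReal : ℝ) : ℂ)) ∂P
      = exp (∫ y, (clusterTransform p s B l y - 1) ∂ancestorIntensity p Λ) := by
  have hm : ∀ a, MeasurableSet (Set.Icc 0 (s a) ×ˢ B a) := fun a => measurableSet_Icc.prod (hB a)
  let N : ℕ → Ω → Measure (ℝ≥0 × ℝ) := fun j ω =>
    decoratedMeasure (fun n => used j n ω) (fun n => x j n ω) (fun n => T j n ω)
  have hN : ∀ ω a, superposition used x T ω (Set.Icc 0 (s a) ×ˢ B a)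
      = ∑' j, N j ω (Set.Icc 0 (s a) ×ˢ B a) := fun ω a => Measure.sum_apply _ (hm a)
  have hfin : ∀ᵐ ω ∂P, ∀ a, ∑' j, N j ω (Set.Icc 0 (s a) ×ˢ B a) ≠ ∞ := by
    rw [ae_all_iff]
    intro a
    filter_upwards [h.ae_superposition_ne_top hp (s a) (hB a) (hΛB a)] with ω hω
    rwa [← hN]
  let Φ : Measure (ℝ≥0 × ℝ) → ℂ := fun m =>
    exp (I * ((∑ a, l a * (m (Set.Icc 0 (s a) ×ˢ B a)).toReal : ℝ) : ℂ))
  have hΦ : Measurable Φ := by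
    have := fun a => (Measure.measurable_coe (hm a)).ennreal_toReal
    fun_prop
  have hfinA : ∀ j, IsFiniteMeasure (Λ.restrict (A j)) := fun j =>
    ⟨by simpa using h.measure_lt_top j⟩
  have hint := integrable_clusterTransform_sub_one Λ hp s hB hΛB l
  rw [ancestorIntensity_eq_sum p Λ h.measurableSet h.disjoint h.iUnion_eq] at hint ⊢
  refine integral_eq_exp_of_hasSum (F := fun j ω => Φ (N j ω))
    (fun j => hΦ.comp (h.measurable_decorated j)) (fun j ω => (norm_exp_I_mul _).le) ?_
    (fun j => (h.decorations j).integral_exp hp s hB l fun a => ?_)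
    (hasSum_integral_measure hint) ?_
  · exact h.indep.comp (fun _ b => Φ (decoratedMeasure (fun n => (b n).1) (fun n => (b n).2.1)
      (fun n => (b n).2.2))) (fun _ => hΦ.comp measurable_decoratedMeasure)
  · filter_upwards [hfin] with ω hω using ENNReal.ne_top_of_tsum_ne_top (hω a) j
  · filter_upwards [hfin] with ω hω
    have hprod : ∀ m, ∏ j ∈ Finset.range m, Φ (N j ω) = exp (I * ((∑ a, l a *
        ∑ j ∈ Finset.range m, (N j ω (Set.Icc 0 (s a) ×ˢ B a)).toReal : ℝ) : ℂ)) := by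
      intro m
      simp only [Φ]
      rw [← exp_sum, ← Finset.mul_sum, ← ofReal_sum, Finset.sum_comm]
      simp_rw [Finset.mul_sum]
    simp_rw [hprod, hN]
    have hc : Continuous (fun r : ℝ => exp (I * (r : ℂ))) := by fun_prop
    refine (hc.tendsto _).comp (tendsto_finsetSum _ fun a _ => Tendsto.const_mul (l a) ?_)
    rw [ENNReal.tsum_toReal_eq (ENNReal.ne_top_of_tsum_ne_top (hω a))]
    exact (ENNReal.summable_toReal (hω a)).hasSum.tendsto_sum_nat

end IsReinforcedConstruction

end Superposition

/-! ### From the cluster transform to the Yule-Simon process -/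

section YuleSimon

lemma markedCount_eq_clusterCount {s : ℝ≥0} {A : Set ℝ} {y : ℝ≥0 × ℝ} (hy : y.2 ∈ A) (T : ℕ → ℝ) :
    markedCount s A (y, T) = clusterCount y.1 s T := by
  simp [markedCount, hy]

lemma markedCount_eq_zero {s : ℝ≥0} {A : Set ℝ} {y : ℝ≥0 × ℝ} (hy : y.2 ∉ A) (T : ℕ → ℝ) :
    markedCount s A (y, T) = 0 := by
  simp [markedCount, hy]

variable {ι : Type*} [Fintype ι]

lemma measurable_yuleSimon_prod (p : ℝ) (t : ℝ≥0) (s : ι → ℝ≥0) (l : ι → ℝ) :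
    Measurable (fun q : ℝ × (ℕ → ℝ) => exp (I * ((∑ a, l a *
      (clusterCount (t * q.1).toNNReal (s a) (fun n => q.2 n / p)).toReal : ℝ) : ℂ))) := by
  have h1 : ∀ a, Measurable (fun q : ℝ × (ℕ → ℝ) =>
      (clusterCount (t * q.1).toNNReal (s a) (fun n => q.2 n / p)).toReal) := by
    intro a
    have h2 : Measurable (fun q : ℝ × (ℕ → ℝ) => ((t * q.1).toNNReal, fun n => q.2 n / p)) := by
      fun_prop
    exact ((measurable_clusterCount (s a)).comp h2).ennreal_toReal
  fun_prop

lemma clusterTransform_univ_eq {p : ℝ} (hp : 0 < p) (s : ι → ℝ≥0) (l : ι → ℝ) (u : ℝ≥0) (r : ℝ) :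
    clusterTransform p s (fun _ => Set.univ) l (u, r) = ∫ T, exp (I * ((∑ a, l a *
      (clusterCount u (s a) (fun n => T n / p)).toReal : ℝ) : ℂ)) ∂birthTimesLaw 1 := by
  rw [clusterTransform, birthTimesLaw_eq_map hp,
    integral_map (Measurable.aemeasurable (by fun_prop))]
  · simp_rw [markedCount_eq_clusterCount (Set.mem_univ _)]
  · have := (measurable_exp_markedCount s (A := fun _ => Set.univ)
      (fun _ => MeasurableSet.univ) l).comp (measurable_prodMk_left (x := (u, r)))
    exact this.aestronglyMeasurable

lemma ae_mem_Ioc_yuleSimonMeasure :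
    ∀ᵐ q ∂yuleSimonMeasure, 0 < q.1 ∧ IsBirthTimes q.2 := by
  have := isProbabilityMeasure_birthTimesLaw one_pos
  have h1 : ∀ᵐ v ∂(volume.restrict (Set.Icc (0 : ℝ) 1)), 0 < v := by
    rw [ae_restrict_congr_set Ioc_ae_eq_Icc.symm]
    filter_upwards [ae_restrict_mem measurableSet_Ioc] with v hv using hv.1
  have h2 := ae_isBirthTimes_one
  exact (Measure.quasiMeasurePreserving_fst.ae h1).and (Measure.quasiMeasurePreserving_snd.ae h2)

/-- Ancestors after t contribute nothing since every s a is at most t. On [0, t] the substitution u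
= tv makes v the uniform variable of the Yule-Simon process and produces the factor t. -/
lemma integral_clusterTransform_sub_one {p : ℝ} (hp : 0 < p) {t : ℝ≥0} (ht : 0 < t) {s : ι → ℝ≥0}
    (hs : ∀ a, 0 < s a) (hst : ∀ a, s a ≤ t) (l : ι → ℝ) (r : ℝ) :
    ∫ u, (clusterTransform p s (fun _ => Set.univ) l (u, r) - 1) ∂lebesgueNNReal
      = t * ∫ y, (exp (I * ((∑ a, l a * yuleSimon p ((s a : ℝ) / t) y : ℝ) : ℂ)) - 1)
          ∂yuleSimonMeasure := by
  have := isProbabilityMeasure_birthTimesLaw one_pos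
  set g : ℝ → ℂ := fun v => clusterTransform p s (fun _ => Set.univ) l (v.toNNReal, r) - 1 with hg
  have hgm : Measurable (fun u => clusterTransform p s (fun _ => Set.univ) l (u, r) - 1) :=
    ((measurable_clusterTransform hp s (fun _ => MeasurableSet.univ) l).comp
      measurable_prodMk_right).sub_const 1
  have hL : ∫ u, (clusterTransform p s (fun _ => Set.univ) l (u, r) - 1) ∂lebesgueNNReal
      = ∫ v in (0 : ℝ)..t, g v := by
    rw [lebesgueNNReal, integral_map (by fun_prop) hgm.aestronglyMeasurable,
      integral_Ici_eq_integral_Ioi, intervalIntegral.integral_of_le t.coe_nonneg]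
    refine setIntegral_eq_of_subset_of_forall_sdiff_eq_zero measurableSet_Ioi
      Set.Ioc_subset_Ioi_self fun v hv => ?_
    have hv' : (t : ℝ) < v := by
      by_contra hcon
      exact hv.2 ⟨hv.1, not_lt.1 hcon⟩
    rw [clusterTransform_eq_one hp, sub_self]
    intro a
    left
    exact (hst a).trans_lt (Real.lt_toNNReal_iff_coe_lt.2 hv')
  set F : ℝ × (ℕ → ℝ) → ℂ := fun q => exp (I * ((∑ a, l a *
      (clusterCount (t * q.1).toNNReal (s a) (fun n => q.2 n / p)).toReal : ℝ) : ℂ)) with hF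
  have hFm : Measurable F := measurable_yuleSimon_prod p t s l
  have hR : ∫ y, (exp (I * ((∑ a, l a * yuleSimon p ((s a : ℝ) / t) y : ℝ) : ℂ)) - 1)
      ∂yuleSimonMeasure = ∫ v in (0 : ℝ)..1, g (t * v) := by
    have h1 : (fun y => exp (I * ((∑ a, l a * yuleSimon p ((s a : ℝ) / t) y : ℝ) : ℂ)) - 1)
        =ᵐ[yuleSimonMeasure] fun q => F q - 1 := by
      filter_upwards [ae_mem_Ioc_yuleSimonMeasure] with q hq
      simp only [hF]
      simp_rw [fun a => toReal_clusterCount_eq_yuleSimon hp hq.1 ht (hs a) hq.2]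
    have hFi : Integrable (fun q => F q - 1)
        ((volume.restrict (Set.Icc (0 : ℝ) 1)).prod (birthTimesLaw 1)) :=
      (integrable_of_norm_le_one hFm.aestronglyMeasurable
        fun q => (norm_exp_I_mul _).le).sub (integrable_const 1)
    rw [integral_congr_ae h1, yuleSimonMeasure, integral_prod _ hFi,
      integral_Icc_eq_integral_Ioc, intervalIntegral.integral_of_le zero_le_one]
    refine integral_congr_ae (ae_of_all _ fun v => ?_)
    simp only [hg]
    have hFv : Measurable (fun T => F (v, T)) := hFm.comp measurable_prodMk_left
    rw [clusterTransform_univ_eq hp, integral_sub (integrable_of_norm_le_one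
      hFv.aestronglyMeasurable fun q => (norm_exp_I_mul _).le) (integrable_const 1)]
    simp [hF]
  rw [hL, hR]
  have := intervalIntegral.smul_integral_comp_mul_left (a := 0) (b := 1) g (t : ℝ)
  rw [mul_zero, mul_one] at this
  rw [← this, real_smul]

/-- Subtracting 1 makes time and mark separate, so that the integral against the product intensity
factorises. The mark 0 is arbitrary: with `Set.univ` the transform does not see it. -/
lemma clusterTransform_const_sub_one {p : ℝ} (hp : 0 < p) (s : ι → ℝ≥0) (A : Set ℝ) (l : ι → ℝ)
    (y : ℝ≥0 × ℝ) :
    clusterTransform p s (fun _ => A) l y - 1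
      = (clusterTransform p s (fun _ => Set.univ) l (y.1, 0) - 1) * A.indicator 1 y.2 := by
  by_cases hy : y.2 ∈ A
  · rw [Set.indicator_of_mem hy, Pi.one_apply, mul_one]
    congr 1
    simp only [clusterTransform]
    simp_rw [markedCount_eq_clusterCount hy, markedCount_eq_clusterCount (Set.mem_univ _)]
  · rw [Set.indicator_of_notMem hy, clusterTransform_eq_one hp _ _ _ _ fun a => Or.inr hy]
    simp

lemma integral_clusterTransform_const {Λ : Measure ℝ} [SigmaFinite Λ] {p : ℝ}
    (hp : p ∈ Set.Ioo (0 : ℝ) 1) {t : ℝ≥0} (ht : 0 < t) {s : ι → ℝ≥0}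
    (hs : ∀ a, 0 < s a) (hst : ∀ a, s a ≤ t) {A : Set ℝ} (hA : MeasurableSet A) (l : ι → ℝ) :
    ∫ y, (clusterTransform p s (fun _ => A) l y - 1) ∂ancestorIntensity p Λ
      = (((1 - p) * (Λ A).toReal * (t : ℝ) : ℝ) : ℂ) *
        ∫ y, (exp (I * ((∑ a, l a * yuleSimon p ((s a : ℝ) / t) y : ℝ) : ℂ)) - 1)
          ∂yuleSimonMeasure := by
  have hind : ∫ r, A.indicator (1 : ℝ → ℂ) r ∂Λ = (Λ A).toReal := by
    rw [integral_indicator hA]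
    simp [Measure.real]
  simp_rw [clusterTransform_const_sub_one hp.1 s A l]
  rw [integral_smul_measure, integral_prod_mul
    (fun u => clusterTransform p s (fun _ => Set.univ) l (u, 0) - 1) (A.indicator (1 : ℝ → ℂ)),
    integral_clusterTransform_sub_one hp.1 ht hs hst l 0, hind,
    ENNReal.toReal_ofReal (by linarith [hp.2]), real_smul]
  push_cast
  ring

end YuleSimon

/-! ### The construction satisfies both conditions -/

section Necessity

variable {Ω : Type*} [MeasurableSpace Ω] {P : Measure Ω} {Λ : Measure ℝ} {p : ℝ} {A : ℕ → Set ℝ}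
  {used : ℕ → ℕ → Ω → Bool} {x : ℕ → ℕ → Ω → ℝ≥0 × ℝ} {T : ℕ → ℕ → Ω → ℕ → ℝ}

theorem IsReinforcedConstruction.isReinforcedPoissonProcess_count [IsProbabilityMeasure P]
    [SigmaFinite Λ] (h : IsReinforcedConstruction Λ p A used x T P) (hp : p ∈ Set.Ioo (0 : ℝ) 1)
    {B : Set ℝ} (hB : MeasurableSet B) (hΛB : Λ B ≠ ∞) :
    IsReinforcedPoissonProcess (Λ B).toReal p (countingProcess (superposition used x T) B) P where
  measurable t := Measure.measurable_measure.1 h.measurable_superposition _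
    (measurableSet_Icc.prod hB)
  finite t := h.ae_superposition_ne_top hp.1 t hB hΛB
  charFun k s t l hmono hs hst := by
    -- For t = 0 there is no time with 0 < s i ≤ t, so k = 0 and both sides are 1.
    rcases eq_or_lt_of_le (zero_le (a := t)) with ht | ht
    · have : IsEmpty (Fin k) := ⟨fun i => by
        have := (hs i).trans_le (hst i)
        rw [← ht] at this
        exact lt_irrefl _ this⟩
      simp
    · rw [← integral_clusterTransform_const hp ht hs hst hB l]
      exact h.integral_exp hp.1 s (fun _ => hB) (fun _ => hΛB) l

/-- A cluster has one mark, which lies in at most one of the disjoint sets, so at most one summand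
is nonzero. This additivity of exponents is the source of the independence in (ii). -/
lemma clusterTransform_sigma {ι : Type*} [Fintype ι] {κ : ι → Type*} [∀ i, Fintype (κ i)]
    (hp : 0 < p) (s : (i : ι) → κ i → ℝ≥0) {B : ι → Set ℝ}
    (hd : Pairwise (fun i j => Disjoint (B i) (B j))) (l : (i : ι) → κ i → ℝ) (y : ℝ≥0 × ℝ) :
    clusterTransform p (fun q : (i : ι) × κ i => s q.1 q.2) (fun q => B q.1)
        (fun q => l q.1 q.2) y - 1
      = ∑ i, (clusterTransform p (s i) (fun _ => B i) (l i) y - 1) := by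
  by_cases hy : ∃ i, y.2 ∈ B i
  · obtain ⟨i, hi⟩ := hy
    have hne : ∀ j, j ≠ i → y.2 ∉ B j := fun j hj hyj => Set.disjoint_left.1 (hd hj) hyj hi
    rw [Finset.sum_eq_single i]
    · congr 1
      simp only [clusterTransform]
      refine integral_congr_ae (ae_of_all _ fun T => ?_)
      simp only
      rw [Fintype.sum_sigma, Finset.sum_eq_single i]
      · intro j _ hj
        exact Finset.sum_eq_zero fun a _ => by simp [markedCount_eq_zero (hne j hj)]
      · simp
    · intro j _ hj
      rw [clusterTransform_eq_one hp _ _ _ _ fun a => Or.inr (hne j hj), sub_self]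
    · simp
  · push Not at hy
    rw [clusterTransform_eq_one hp (fun q : (i : ι) × κ i => s q.1 q.2) (fun q => B q.1) _ y
      fun a => Or.inr (hy a.1), sub_self,
      Finset.sum_eq_zero fun i _ => ?_]
    rw [clusterTransform_eq_one hp _ _ _ _ fun a => Or.inr (hy i), sub_self]

theorem IsReinforcedConstruction.iIndepFun_counts [IsProbabilityMeasure P]
    [SigmaFinite Λ] (h : IsReinforcedConstruction Λ p A used x T P) (hp : 0 < p) {ι : Type*}
    [Finite ι] {B : ι → Set ℝ} (hB : ∀ i, MeasurableSet (B i)) (hΛB : ∀ i, Λ (B i) ≠ ∞)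
    (hd : Pairwise (fun i j => Disjoint (B i) (B j))) :
    iIndepFun (fun i ω t => countingProcess (superposition used x T) (B i) t ω) P := by
  have hmeas : ∀ i t, Measurable (countingProcess (superposition used x T) (B i) t) :=
    fun i t => Measure.measurable_measure.1 h.measurable_superposition _
      (measurableSet_Icc.prod (hB i))
  refine iIndepFun.iIndepFun_process hmeas fun K J => ?_
  refine iIndepFun_of_integral_exp_toReal
    (X := fun (i : K) (j : J i) ω => countingProcess (superposition used x T) (B i) j ω)
    (fun i j => hmeas _ _) (fun i j => h.ae_superposition_ne_top hp _ (hB i) (hΛB i)) fun l => ?_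
  have h1 := h.integral_exp hp (fun q : (i : K) × J i => (q.2 : ℝ≥0)) (fun q => hB q.1)
    (fun q => hΛB q.1) (fun q => l q.1 q.2)
  have h2 : ∀ i : K, _ := fun i => h.integral_exp hp (fun j : J i => (j : ℝ≥0)) (fun _ => hB i)
    (fun _ => hΛB i) (l i)
  simp_rw [Fintype.sum_sigma] at h1
  simp only [countingProcess]
  rw [h1]
  simp_rw [h2]
  rw [← exp_sum, ← integral_finsetSum Finset.univ (f := fun (i : K) y =>
    clusterTransform p (fun j : J i => (j : ℝ≥0)) (fun _ => B i) (l i) y - 1) fun i _ =>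
    integrable_clusterTransform_sub_one Λ hp _ (fun _ => hB i) (fun _ => hΛB i) _]
  congr 1
  refine integral_congr_ae (ae_of_all _ fun y => ?_)
  exact clusterTransform_sigma hp (fun (i : K) (j : J i) => (j : ℝ≥0)) (B := fun i : K => B i)
    (fun i j hij => hd (Subtype.coe_injective.ne hij)) l y

end Necessity

/-! ### Finite-dimensional laws determine the law of a random measure -/

section RandomMeasureLaw

variable {E : Type*} [mE : MeasurableSpace E] {S : Set (Set E)} {R : ℕ → Set E}

open Classical in
/-- The measure itself if it is finite on all sets `R n`, and `0` otherwise. -/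
noncomputable def finitePart (R : ℕ → Set E) (m : Measure E) : Measure E :=
  if ∀ n, m (R n) ≠ ∞ then m else 0

/-- Only the evaluations on S are assumed measurable. After the truncation the restrictions to the R
n are finite measures, for which a generating π-system suffices; disjoint slices then reassemble the
measure. -/
lemma measurable_finitePart (hgen : mE = MeasurableSpace.generateFrom S) (hpi : IsPiSystem S)
    (hR : ∀ n, R n ∈ S) (hU : (⋃ n, R n) = Set.univ) {α : Type*} [MeasurableSpace α]
    {N : α → Measure E} (hN : ∀ B ∈ S, Measurable (fun a => N a B)) :
    Measurable (fun a => finitePart R (N a)) := by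
  have hSm : ∀ B ∈ S, MeasurableSet B := fun B hB => by
    rw [hgen]
    exact MeasurableSpace.measurableSet_generateFrom hB
  have hF : MeasurableSet {a | ∀ n, N a (R n) ≠ ∞} := by
    rw [Set.ofPred_forall]
    exact MeasurableSet.iInter fun n => (hN _ (hR n) (measurableSet_singleton ∞)).compl
  have hK : ∀ B ∈ S, Measurable (fun a => finitePart R (N a) B) := by
    intro B hB
    have : (fun a => finitePart R (N a) B)
        = Set.indicator {a | ∀ n, N a (R n) ≠ ∞} (fun a => N a B) := by
      funext a
      by_cases h : ∀ n, N a (R n) ≠ ∞ <;> simp [finitePart, h]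
    rw [this]
    exact (hN B hB).indicator hF
  have hKR : ∀ a n, finitePart R (N a) (R n) ≠ ∞ := by
    intro a n
    by_cases h : ∀ n, N a (R n) ≠ ∞
    · rw [finitePart, if_pos h]
      exact h n
    · simp [finitePart, h]
  have hres : ∀ n, Measurable (fun a => (finitePart R (N a)).restrict (R n)) := by
    intro n
    have : ∀ a, IsFiniteMeasure ((finitePart R (N a)).restrict (R n)) := fun a =>
      ⟨by simpa using (hKR a n).lt_top⟩
    refine Measurable.measure_of_isPiSystem hgen hpi (fun B hB => ?_) ?_
    · simp_rw [Measure.restrict_apply (hSm B hB)]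
      rcases (B ∩ R n).eq_empty_or_nonempty with h | h
      · simp [h]
      · exact hK _ (hpi B hB _ (hR n) h)
    · simp_rw [Measure.restrict_apply_univ]
      exact hK _ (hR n)
  refine Measure.measurable_of_measurable_coe _ fun B hB => ?_
  have hRm : ∀ n, MeasurableSet (R n) := fun n => hSm _ (hR n)
  have hdis : ∀ n, MeasurableSet (B ∩ disjointed R n) := fun n =>
    hB.inter (MeasurableSet.disjointed hRm n)
  have hsum : ∀ a, finitePart R (N a) B
      = ∑' n, (finitePart R (N a)).restrict (R n) (B ∩ disjointed R n) := by
    intro a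
    have h1 : B = ⋃ n, B ∩ disjointed R n := by
      rw [← Set.inter_iUnion, iUnion_disjointed, hU, Set.inter_univ]
    conv_lhs => rw [h1]
    rw [measure_iUnion (fun i j hij => ((disjoint_disjointed R hij).mono
      Set.inter_subset_right Set.inter_subset_right)) hdis]
    refine tsum_congr fun n => ?_
    rw [Measure.restrict_apply (hdis n), Set.inter_eq_left.2
      (Set.inter_subset_right.trans (disjointed_subset R n))]
  simp_rw [hsum]
  exact Measurable.tsum fun n => Measure.measurable_measure.1 (hres n) _ (hdis n)

variable {Ω Ω' : Type*} [MeasurableSpace Ω] [MeasurableSpace Ω'] {P : Measure Ω} {P' : Measure Ω'}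

/-- The finite marginals determine the law of the whole family of evaluations on S, and `finitePart`
recovers the measure measurably from that family, almost surely without changing it. -/
theorem map_randomMeasure_eq [IsFiniteMeasure P] [IsFiniteMeasure P']
    (hgen : mE = MeasurableSpace.generateFrom S) (hpi : IsPiSystem S)
    (hR : ∀ n, R n ∈ S) (hU : (⋃ n, R n) = Set.univ) {N : Ω → Measure E} {N' : Ω' → Measure E}
    (hN : Measurable N) (hN' : Measurable N') (hNR : ∀ n, ∀ᵐ ω ∂P, N ω (R n) ≠ ∞)
    (hNR' : ∀ n, ∀ᵐ ω ∂P', N' ω (R n) ≠ ∞)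
    (hfdd : ∀ I : Finset S, P.map (fun ω (B : I) => N ω (B : Set E))
      = P'.map (fun ω (B : I) => N' ω (B : Set E))) :
    P.map N = P'.map N' := by
  have hSm : ∀ B ∈ S, MeasurableSet B := fun B hB => by
    rw [hgen]
    exact MeasurableSpace.measurableSet_generateFrom hB
  let ev : Measure E → S → ℝ≥0∞ := fun m B => m B
  have hev : Measurable ev := measurable_pi_lambda _ fun B => Measure.measurable_coe (hSm B B.2)
  have hlaw : P.map (ev ∘ N) = P'.map (ev ∘ N') := by
    have := fun I : Finset S => Measure.isFiniteMeasure_map P (fun ω (B : I) => N ω (B : Set E))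
    refine IsProjectiveLimit.unique (P := fun I : Finset S =>
      P.map (fun ω (B : I) => N ω (B : Set E))) (fun I => ?_) (fun I => ?_)
    · rw [Measure.map_map (by fun_prop) (hev.comp hN)]
      rfl
    · rw [Measure.map_map (by fun_prop) (hev.comp hN')]
      exact (hfdd I).symm
  -- `Measure E` carries here the coarser σ-algebra generated by the evaluations on S, so events
  -- about `finitePart R` are preimages under `ev`.
  have hG : @Measurable _ _ (MeasurableSpace.comap ev inferInstance) _ (finitePart R) :=
    @measurable_finitePart E mE S R hgen hpi hR hU (Measure E)
      (MeasurableSpace.comap ev inferInstance) id (fun B hB =>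
        (measurable_pi_apply (⟨B, hB⟩ : S)).comp (comap_measurable ev))
  have e1 : N =ᵐ[P] fun ω => finitePart R (N ω) := by
    filter_upwards [ae_all_iff.2 hNR] with ω hω
    rw [finitePart, if_pos hω]
  have e2 : N' =ᵐ[P'] fun ω => finitePart R (N' ω) := by
    filter_upwards [ae_all_iff.2 hNR'] with ω hω
    rw [finitePart, if_pos hω]
  ext B hB
  obtain ⟨C, hC, hCB⟩ := hG hB
  have h1 : (fun ω => finitePart R (N ω)) ⁻¹' B = (ev ∘ N) ⁻¹' C := by
    rw [Set.preimage_comp, hCB]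
    rfl
  have h2 : (fun ω => finitePart R (N' ω)) ⁻¹' B = (ev ∘ N') ⁻¹' C := by
    rw [Set.preimage_comp, hCB]
    rfl
  rw [Measure.map_apply hN hB, Measure.map_apply hN' hB, measure_congr (e1.preimage B),
    measure_congr (e2.preimage B), h1, h2, ← Measure.map_apply (hev.comp hN) hC,
    ← Measure.map_apply (hev.comp hN') hC, hlaw]

end RandomMeasureLaw

/-! ### The two conditions determine the law -/

section Uniqueness

variable {Ω Ω' : Type*} [MeasurableSpace Ω] [MeasurableSpace Ω'] {P : Measure Ω} {P' : Measure Ω'}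

/-- The defining formula needs strictly increasing times. An arbitrary finite family reduces to it
by sorting the distinct times and adding the coefficients of equal ones. -/
lemma IsReinforcedPoissonProcess.integral_exp_eq {c p : ℝ} {X : ℝ≥0 → Ω → ℝ≥0∞}
    {X' : ℝ≥0 → Ω' → ℝ≥0∞} (h : IsReinforcedPoissonProcess c p X P)
    (h' : IsReinforcedPoissonProcess c p X' P') {ι : Type*} [Fintype ι] (s : ι → ℝ≥0)
    (hs : ∀ a, 0 < s a) (l : ι → ℝ) :
    ∫ ω, exp (I * ((∑ a, l a * (X (s a) ω).toReal : ℝ) : ℂ)) ∂P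
      = ∫ ω, exp (I * ((∑ a, l a * (X' (s a) ω).toReal : ℝ) : ℂ)) ∂P' := by
  classical
  let F : Finset ℝ≥0 := Finset.univ.image s
  let σ : Fin F.card ↪o ℝ≥0 := F.orderEmbOfFin rfl
  let L : Fin F.card → ℝ := fun i => ∑ a with s a = σ i, l a
  have hsum : ∀ v : ℝ≥0 → ℝ, ∑ a, l a * v (s a) = ∑ i, L i * v (σ i) := by
    intro v
    have h1 : ∑ i, L i * v (σ i) = ∑ r ∈ F, (∑ a with s a = r, l a) * v r := by
      have h2 := Finset.sum_map Finset.univ σ.toEmbedding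
        (fun r => (∑ a with s a = r, l a) * v r)
      rw [Finset.map_orderEmbOfFin_univ F rfl] at h2
      exact h2.symm
    rw [h1, ← Finset.sum_fiberwise_of_maps_to (t := F) (g := s)
      (fun a _ => Finset.mem_image_of_mem s (Finset.mem_univ a))]
    refine Finset.sum_congr rfl fun r _ => ?_
    rw [Finset.sum_mul]
    exact Finset.sum_congr rfl fun a ha => by rw [(Finset.mem_filter.1 ha).2]
  have hσ : ∀ i, σ i ∈ F := fun i => F.orderEmbOfFin_mem rfl i
  have hpos : ∀ i, 0 < σ i := by
    intro i
    obtain ⟨a, -, ha⟩ := Finset.mem_image.1 (hσ i)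
    rw [← ha]
    exact hs a
  have hle : ∀ i, σ i ≤ F.sup id := fun i => Finset.le_sup (f := id) (hσ i)
  rw [integral_congr_ae (ae_of_all _ fun ω => by rw [hsum fun r => (X r ω).toReal]),
    integral_congr_ae (μ := P') (ae_of_all _ fun ω => by rw [hsum fun r => (X' r ω).toReal])]
  rw [h.charFun F.card σ (F.sup id) L σ.strictMono hpos hle,
    h'.charFun F.card σ (F.sup id) L σ.strictMono hpos hle]

/-- The atom of the algebra generated by the sets `A a` that lies in `A a` exactly when `b a`. -/
def atom {ι : Type*} (A : ι → Set ℝ) (b : ι → Bool) : Set ℝ :=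
  (⋃ a, A a) ∩ {r | ∀ a, r ∈ A a ↔ b a = true}

lemma measurableSet_atom {ι : Type*} [Finite ι] {A : ι → Set ℝ} (hA : ∀ a, MeasurableSet (A a))
    (b : ι → Bool) : MeasurableSet (atom A b) := by
  refine (MeasurableSet.iUnion hA).inter ?_
  rw [Set.ofPred_forall]
  refine MeasurableSet.iInter fun a => ?_
  cases b a
  · have : {r | r ∈ A a ↔ false = true} = (A a)ᶜ := by
      ext
      simp
    rw [this]
    exact (hA a).compl
  · simpa using hA a

lemma pairwise_disjoint_atom {ι : Type*} (A : ι → Set ℝ) :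
    Pairwise (fun b c => Disjoint (atom A b) (atom A c)) := by
  intro b c hbc
  rw [Set.disjoint_left]
  rintro r ⟨-, hb⟩ ⟨-, hc⟩
  refine hbc (funext fun a => ?_)
  have := (hb a).symm.trans (hc a)
  rwa [Bool.eq_iff_iff]

/-- The intersection with the union in `atom` matters here: it makes the atom of the constant
`false` empty, instead of a complement of possibly infinite measure. -/
lemma measure_atom_ne_top {ι : Type*} [Finite ι] {Λ : Measure ℝ} {A : ι → Set ℝ}
    (hA : ∀ a, Λ (A a) ≠ ∞) (b : ι → Bool) : Λ (atom A b) ≠ ∞ := by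
  have := Fintype.ofFinite ι
  refine ((measure_mono Set.inter_subset_left).trans_lt
    ((measure_iUnion_fintype_le Λ A).trans_lt ?_)).ne
  exact ENNReal.sum_lt_top.2 fun a _ => (hA a).lt_top

lemma measure_prod_eq_sum_atom {ι : Type*} [Fintype ι] [DecidableEq ι] {A : ι → Set ℝ}
    (hA : ∀ a, MeasurableSet (A a)) (m : Measure (ℝ≥0 × ℝ)) (t : ℝ≥0) (a : ι) :
    m (Set.Icc 0 t ×ˢ A a)
      = ∑ b : ι → Bool, if b a = true then m (Set.Icc 0 t ×ˢ atom A b) else 0 := by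
  classical
  have h1 : Set.Icc 0 t ×ˢ A a
      = ⋃ b ∈ Finset.univ.filter (fun b : ι → Bool => b a = true), Set.Icc 0 t ×ˢ atom A b := by
    ext ⟨u, r⟩
    simp only [Set.mem_prod, Set.mem_iUnion, Finset.mem_filter, Finset.mem_univ, true_and,
      exists_prop]
    constructor
    · rintro ⟨hu, hr⟩
      exact ⟨fun a => decide (r ∈ A a), by simpa using hr, hu, Set.mem_iUnion.2 ⟨a, hr⟩,
        fun a => by simp⟩
    · rintro ⟨b, hb, hu, -, hr⟩
      exact ⟨hu, (hr a).2 hb⟩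
  rw [h1, measure_biUnion_finset, Finset.sum_filter]
  · intro b _ c _ hbc
    exact Set.disjoint_prod.2 (Or.inr (pairwise_disjoint_atom A hbc))
  · exact fun b _ => measurableSet_Icc.prod (measurableSet_atom hA b)

/-- The two conditions characterising noise reinforced Poisson point processes. -/
structure HasReinforcedCounts (Λ : Measure ℝ) (p : ℝ) (N : Ω → Measure (ℝ≥0 × ℝ))
    (P : Measure Ω) : Prop where
  process : ∀ A : Set ℝ, MeasurableSet A → Λ A < ∞ →
    IsReinforcedPoissonProcess (Λ A).toReal p (countingProcess N A) P
  indep : ∀ (k : ℕ) (A : Fin k → Set ℝ), (∀ i, MeasurableSet (A i)) → (∀ i, Λ (A i) < ∞) →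
    Pairwise (fun i j => Disjoint (A i) (A j)) →
    iIndepFun (fun i ω t => countingProcess N (A i) t ω) P

variable {Λ : Measure ℝ} {p : ℝ} {N : Ω → Measure (ℝ≥0 × ℝ)} {N' : Ω' → Measure (ℝ≥0 × ℝ)}

/-- Each count is the sum of the counts over the atoms inside A a, and the atoms are disjoint, so
(ii) splits the characteristic function into factors that (i) determines. -/
lemma HasReinforcedCounts.integral_exp_eq_prod (h : HasReinforcedCounts Λ p N P)
    {ι : Type*} [Fintype ι] [DecidableEq ι]
    (s : ι → ℝ≥0) {A : ι → Set ℝ} (hA : ∀ a, MeasurableSet (A a)) (hΛA : ∀ a, Λ (A a) ≠ ∞)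
    (l : ι → ℝ) :
    ∫ ω, exp (I * ((∑ a, l a * (N ω (Set.Icc 0 (s a) ×ˢ A a)).toReal : ℝ) : ℂ)) ∂P
      = ∏ b : ι → Bool, ∫ ω, exp (I * ((∑ a, (if b a = true then l a else 0) *
          (countingProcess N (atom A b) (s a) ω).toReal : ℝ) : ℂ)) ∂P := by
  have hproc := fun b : ι → Bool => h.process (atom A b) (measurableSet_atom hA b)
    (measure_atom_ne_top hΛA b).lt_top
  have hind : iIndepFun (fun (b : ι → Bool) ω t => countingProcess N (atom A b) t ω) P := by
    let e := Fintype.equivFin (ι → Bool)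
    have h1 := h.indep _ (fun i => atom A (e.symm i)) (fun i => measurableSet_atom hA _)
      (fun i => (measure_atom_ne_top hΛA _).lt_top)
      (fun i j hij => pairwise_disjoint_atom A (e.symm.injective.ne hij))
    simpa using h1.precomp e.injective
  have hf : ∀ b : ι → Bool, Measurable (fun v : ℝ≥0 → ℝ≥0∞ =>
      exp (I * ((∑ a, (if b a = true then l a else 0) * (v (s a)).toReal : ℝ) : ℂ))) := by
    intro b
    fun_prop
  rw [← hind.integral_fun_prod_comp
    (fun b => (measurable_pi_lambda _ (hproc b).measurable).aemeasurable)
    (fun b => (hf b).aestronglyMeasurable)]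
  have hfin : ∀ᵐ ω ∂P, ∀ (b : ι → Bool) a, countingProcess N (atom A b) (s a) ω ≠ ∞ := by
    simp_rw [ae_all_iff]
    exact fun b a => (hproc b).finite _
  refine integral_congr_ae ?_
  filter_upwards [hfin] with ω hω
  rw [← exp_sum, ← Finset.mul_sum, ← ofReal_sum, Finset.sum_comm]
  congr 3
  refine Finset.sum_congr rfl fun a _ => ?_
  rw [measure_prod_eq_sum_atom hA, ENNReal.toReal_sum, Finset.mul_sum]
  · refine Finset.sum_congr rfl fun b _ => ?_
    split_ifs
    · rfl
    · simp
  · intro b _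
    split_ifs
    · exact hω b a
    · simp

/-- The rectangles `[0, t] × A` with `t > 0` and `A` of finite measure. -/
def rectangles (Λ : Measure ℝ) : Set (Set (ℝ≥0 × ℝ)) :=
  Set.image2 (· ×ˢ ·) {C | ∃ t : ℝ≥0, 0 < t ∧ C = Set.Icc 0 t}
    {A : Set ℝ | MeasurableSet A ∧ Λ A < ∞}

lemma isPiSystem_rectangles : IsPiSystem (rectangles Λ) := by
  refine IsPiSystem.prod ?_ ?_
  · rintro _ ⟨t, ht, rfl⟩ _ ⟨r, hr, rfl⟩ -
    exact ⟨min t r, lt_min ht hr, by rw [Set.Icc_inter_Icc, max_self]⟩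
  · rintro A ⟨hA, hA'⟩ B ⟨hB, -⟩ -
    exact ⟨hA.inter hB, (measure_mono Set.inter_subset_left).trans_lt hA'⟩

lemma iUnion_Icc_natCast_succ : ⋃ n : ℕ, Set.Icc (0 : ℝ≥0) (n + 1) = Set.univ := by
  refine Set.eq_univ_of_forall fun r => ?_
  obtain ⟨n, hn⟩ := exists_nat_ge r
  exact Set.mem_iUnion.2 ⟨n, zero_le, hn.trans (by simp)⟩

lemma generateFrom_rectangles [SigmaFinite Λ] :
    (inferInstance : MeasurableSpace (ℝ≥0 × ℝ)) = MeasurableSpace.generateFrom (rectangles Λ) := by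
  refine (generateFrom_eq_prod ?_ ?_ ?_ ?_).symm
  · refine le_antisymm (MeasurableSpace.generateFrom_le ?_) ?_
    · rintro _ ⟨t, -, rfl⟩
      exact measurableSet_Icc
    · rw [BorelSpace.measurable_eq (α := ℝ≥0), borel_eq_generateFrom_Iic]
      refine MeasurableSpace.generateFrom_le ?_
      rintro _ ⟨t, rfl⟩
      -- Intervals of positive length only are available, as the characteristic functions are
      -- prescribed at positive times; t = 0 is reached as a limit.
      have : Set.Iic t = ⋂ n : ℕ, Set.Icc 0 (t + 1 / ((n : ℝ≥0) + 1)) := by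
        ext r
        simp only [Set.mem_Iic, Set.mem_iInter, Set.mem_Icc, zero_le, true_and]
        refine ⟨fun hr n => hr.trans (by simp), fun hr => ?_⟩
        refine ge_of_tendsto' (x := atTop) (f := fun n : ℕ => t + 1 / ((n : ℝ≥0) + 1)) ?_ hr
        have := (tendsto_one_div_add_atTop_nhds_zero_nat (𝕜 := ℝ≥0)).const_add t
        simpa using this
      rw [this]
      refine MeasurableSet.iInter fun n => MeasurableSpace.measurableSet_generateFrom ?_
      exact ⟨_, by positivity, rfl⟩
  · refine le_antisymm (MeasurableSpace.generateFrom_le fun A hA => hA.1) fun B hB => ?_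
    have : B = ⋃ n, B ∩ spanningSets Λ n := by
      rw [← Set.inter_iUnion, iUnion_spanningSets, Set.inter_univ]
    rw [this]
    refine MeasurableSet.iUnion fun n => MeasurableSpace.measurableSet_generateFrom ?_
    exact ⟨hB.inter (measurableSet_spanningSets Λ n),
      (measure_mono Set.inter_subset_right).trans_lt (measure_spanningSets_lt_top Λ n)⟩
  · exact ⟨fun n : ℕ => Set.Icc 0 ((n : ℝ≥0) + 1), fun n => ⟨_, by positivity, rfl⟩,
      iUnion_Icc_natCast_succ⟩
  · exact ⟨spanningSets Λ, fun n => ⟨measurableSet_spanningSets Λ n,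
      measure_spanningSets_lt_top Λ n⟩, iUnion_spanningSets Λ⟩

theorem HasReinforcedCounts.map_eq [IsProbabilityMeasure P] [IsProbabilityMeasure P']
    [SigmaFinite Λ] (h : HasReinforcedCounts Λ p N P) (h' : HasReinforcedCounts Λ p N' P')
    (hN : Measurable N) (hN' : Measurable N') : P.map N = P'.map N' := by
  classical
  let R : ℕ → Set (ℝ≥0 × ℝ) := fun n => Set.Icc 0 ((n : ℝ≥0) + 1) ×ˢ spanningSets Λ n
  have hR : ∀ n, R n ∈ rectangles Λ := fun n =>
    ⟨_, ⟨_, by positivity, rfl⟩, _, ⟨measurableSet_spanningSets Λ n,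
      measure_spanningSets_lt_top Λ n⟩, rfl⟩
  have hU : (⋃ n, R n) = Set.univ := by
    refine Set.eq_univ_of_forall fun ⟨u, r⟩ => ?_
    obtain ⟨n, hn⟩ := exists_nat_ge u
    obtain ⟨m, hm⟩ := Set.mem_iUnion.1
      ((iUnion_spanningSets Λ).symm ▸ Set.mem_univ r : r ∈ ⋃ n, spanningSets Λ n)
    refine Set.mem_iUnion.2 ⟨max n m, ⟨zero_le, hn.trans ?_⟩,
      monotone_spanningSets Λ (le_max_right n m) hm⟩
    have : (n : ℝ≥0) ≤ (max n m : ℕ) := by exact_mod_cast le_max_left n m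
    exact this.trans (by simp)
  refine map_randomMeasure_eq generateFrom_rectangles isPiSystem_rectangles hR hU hN hN'
    (fun n => (h.process _ (measurableSet_spanningSets Λ n)
      (measure_spanningSets_lt_top Λ n)).finite _)
    (fun n => (h'.process _ (measurableSet_spanningSets Λ n)
      (measure_spanningSets_lt_top Λ n)).finite _) fun J => ?_
  have hJ : ∀ B : J, ∃ (t : ℝ≥0) (A : Set ℝ), 0 < t ∧ MeasurableSet A ∧ Λ A < ∞ ∧
      Set.Icc 0 t ×ˢ A = ((B : rectangles Λ) : Set (ℝ≥0 × ℝ)) := by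
    rintro ⟨⟨_, _, ⟨t, ht, rfl⟩, A, ⟨hA, hA'⟩, rfl⟩, _⟩
    exact ⟨t, A, ht, hA, hA', rfl⟩
  choose t A ht hA hΛA hB using hJ
  simp_rw [← hB]
  refine map_eq_of_integral_exp_toReal_eq
    (fun B => Measure.measurable_measure.1 hN _ (measurableSet_Icc.prod (hA B)))
    (fun B => Measure.measurable_measure.1 hN' _ (measurableSet_Icc.prod (hA B)))
    (fun B => (h.process _ (hA B) (hΛA B)).finite _)
    (fun B => (h'.process _ (hA B) (hΛA B)).finite _) fun l => ?_
  rw [h.integral_exp_eq_prod t hA (fun B => (hΛA B).ne) l,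
    h'.integral_exp_eq_prod t hA (fun B => (hΛA B).ne) l]
  refine Finset.prod_congr rfl fun b _ => ?_
  exact (h.process _ (measurableSet_atom hA b)
    (measure_atom_ne_top (fun B => (hΛA B).ne) b).lt_top).integral_exp_eq
    (h'.process _ (measurableSet_atom hA b)
    (measure_atom_ne_top (fun B => (hΛA B).ne) b).lt_top) t ht _

end Uniqueness

/-! ### Existence of Poisson random measures -/

section PoissonExistence

variable {E : Type*} [MeasurableSpace E]

lemma exists_isProbabilityMeasure_smul [Nonempty E] (m : Measure E) [IsFiniteMeasure m] :
    ∃ (ρ : Measure E) (r : ℝ≥0), IsProbabilityMeasure ρ ∧ m = (r : ℝ≥0∞) • ρ := by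
  rcases eq_or_ne m 0 with hm | hm
  -- The zero measure cannot be normalised; any probability measure with weight 0 serves.
  · exact ⟨Measure.dirac (Classical.arbitrary E), 0, inferInstance, by simp [hm]⟩
  · have : NeZero m := ⟨hm⟩
    refine ⟨(m Set.univ)⁻¹ • m, (m Set.univ).toNNReal, inferInstance, ?_⟩
    rw [ENNReal.coe_toNNReal (measure_ne_top _ _), smul_smul,
      ENNReal.mul_inv_cancel (by simpa using hm) (measure_ne_top _ _), one_smul]

/-- The law of a Poisson number of parameter `r` and an independent sequence of independent points
with law `ρ`. -/
noncomputable def poissonSampleLaw (r : ℝ≥0) (ρ : Measure E) : Measure (ℕ × (ℕ → E)) :=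
  (poissonMeasure r).prod (Measure.infinitePi fun _ => ρ)

instance (r : ℝ≥0) (ρ : Measure E) [IsProbabilityMeasure ρ] :
    IsProbabilityMeasure (poissonSampleLaw r ρ) := by
  unfold poissonSampleLaw
  infer_instance

/-- The number of points of a finite sample that lie in `B`. -/
noncomputable def sampleCount (B : Set E) (q : ℕ × (ℕ → E)) : ℝ≥0∞ :=
  ∑ i ∈ Finset.range q.1, B.indicator 1 (q.2 i)

/-- The product of `f` over the points of a finite sample. -/
def sampleProd (f : E → ℂ) (q : ℕ × (ℕ → E)) : ℂ := ∏ i ∈ Finset.range q.1, f (q.2 i)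

omit [MeasurableSpace E] in
lemma norm_sampleProd_le_one {f : E → ℂ} (hf : ∀ y, ‖f y‖ ≤ 1) (q : ℕ × (ℕ → E)) :
    ‖sampleProd f q‖ ≤ 1 := norm_prod_le_one _ fun _ => hf _

lemma measurable_sampleCount {B : Set E} (hB : MeasurableSet B) : Measurable (sampleCount B) := by
  have hind : Measurable (B.indicator (1 : E → ℝ≥0∞)) := measurable_one.indicator hB
  have h : ∀ n : ℕ, Measurable (fun w : ℕ → E => ∑ i ∈ Finset.range n,
      B.indicator (1 : E → ℝ≥0∞) (w i)) := fun n =>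
    Finset.measurable_sum _ fun i _ => hind.comp (measurable_pi_apply i)
  exact measurable_from_prod_countable_right h

lemma measurable_sampleProd {f : E → ℂ} (hf : Measurable f) : Measurable (sampleProd f) := by
  have h : ∀ n : ℕ, Measurable (fun w : ℕ → E => ∏ i ∈ Finset.range n, f (w i)) := fun n =>
    Finset.measurable_prod _ fun i _ => hf.comp (measurable_pi_apply i)
  exact measurable_from_prod_countable_right h

lemma measurable_sampleCount_apply {B : Set E} (hB : MeasurableSet B) (b : ℕ) :
    Measurable (fun ω : ℕ → ℕ × (ℕ → E) => sampleCount B (ω b)) :=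
  (measurable_sampleCount hB).comp (measurable_pi_apply b)

lemma measurable_sampleProd_apply {f : E → ℂ} (hf : Measurable f) (b : ℕ) :
    Measurable (fun ω : ℕ → ℕ × (ℕ → E) => sampleProd f (ω b)) :=
  (measurable_sampleProd hf).comp (measurable_pi_apply b)

lemma lintegral_sampleCount (r : ℝ≥0) (ρ : Measure E) [IsProbabilityMeasure ρ] {B : Set E}
    (hB : MeasurableSet B) : ∫⁻ q, sampleCount B q ∂poissonSampleLaw r ρ = r * ρ B := by
  have hind : Measurable (B.indicator (1 : E → ℝ≥0∞)) := measurable_one.indicator hB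
  have h1 : ∀ i : ℕ, ∫⁻ w : ℕ → E, B.indicator 1 (w i) ∂Measure.infinitePi (fun _ => ρ) = ρ B := by
    intro i
    rw [← lintegral_map hind (measurable_pi_apply i),
      Measure.infinitePi_map_eval (fun _ : ℕ => ρ) i, lintegral_indicator_one hB]
  rw [poissonSampleLaw, lintegral_prod _ (measurable_sampleCount hB).aemeasurable]
  simp only [sampleCount]
  have h2 : ∀ n : ℕ, ∫⁻ w : ℕ → E, ∑ i ∈ Finset.range n, B.indicator 1 (w i)
      ∂Measure.infinitePi (fun _ => ρ) = n * ρ B := by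
    intro n
    have h3 : ∀ i : ℕ, Measurable (fun w : ℕ → E => B.indicator (1 : E → ℝ≥0∞) (w i)) :=
      fun i => hind.comp (measurable_pi_apply i)
    rw [lintegral_finsetSum _ fun i _ => h3 i]
    simp [h1]
  simp_rw [h2]
  rw [lintegral_mul_const _ .of_discrete, lintegral_poissonMeasure_natCast]

/-- Given the sample size n, the mean is (∫ f dρ)^n; the Poisson generating function then sums over
n. -/
lemma integral_sampleProd (r : ℝ≥0) (ρ : Measure E) [IsProbabilityMeasure ρ] {f : E → ℂ}
    (hf : Measurable f) (hf1 : ∀ y, ‖f y‖ ≤ 1) :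
    ∫ q, sampleProd f q ∂poissonSampleLaw r ρ
      = exp (∫ y, (f y - 1) ∂((r : ℝ≥0∞) • ρ)) := by
  rw [poissonSampleLaw, integral_prod _ (integrable_of_norm_le_one
    (measurable_sampleProd hf).aestronglyMeasurable (norm_sampleProd_le_one hf1))]
  have hind : iIndepFun (fun (i : ℕ) (w : ℕ → E) => w i) (Measure.infinitePi fun _ => ρ) :=
    iIndepFun_infinitePi (X := fun _ y => y) fun _ => measurable_id
  have h1 : ∀ n : ℕ, ∫ w, sampleProd f (n, w) ∂Measure.infinitePi (fun _ => ρ)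
      = (∫ y, f y ∂ρ) ^ n := by
    intro n
    have h2 := (hind.restrict (Finset.range n)).integral_fun_prod_comp (f := fun _ => f)
      (fun i => (measurable_pi_apply _).aemeasurable) (fun _ => hf.aestronglyMeasurable)
    simp only [Finset.restrict] at h2
    have h3 : ∀ i : ℕ, ∫ w : ℕ → E, f (w i) ∂Measure.infinitePi (fun _ => ρ) = ∫ y, f y ∂ρ := by
      intro i
      rw [← integral_map (φ := fun w : ℕ → E => w i) (measurable_pi_apply i).aemeasurable
        hf.aestronglyMeasurable, Measure.infinitePi_map_eval (fun _ : ℕ => ρ) i]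
    simp_rw [h3] at h2
    simp only [Finset.prod_const, Finset.card_univ, Fintype.card_coe, Finset.card_range] at h2
    rw [← h2]
    refine integral_congr_ae (ae_of_all _ fun w => ?_)
    exact (Finset.prod_coe_sort (Finset.range n) (fun i => f (w i))).symm
  simp_rw [h1]
  rw [integral_pow_poissonMeasure, integral_smul_measure,
    integral_sub (integrable_of_norm_le_one hf.aestronglyMeasurable hf1) (integrable_const 1)]
  simp

/-- A point is in use if its rank in its sample is smaller than the size of the sample. -/
def sampleUsed (n : ℕ) (ω : ℕ → ℕ × (ℕ → E)) : Bool :=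
  decide (n.unpair.2 < (ω n.unpair.1).1)

/-- The points of a sequence of samples, in a sequence. -/
def samplePoint (n : ℕ) (ω : ℕ → ℕ × (ℕ → E)) : E := (ω n.unpair.1).2 n.unpair.2

lemma measurable_sampleUsed (n : ℕ) : Measurable (sampleUsed (E := E) n) := by
  have h1 : Measurable (fun ω : ℕ → ℕ × (ℕ → E) => (ω n.unpair.1).1) := by fun_prop
  exact (Measurable.of_discrete (f := fun k : ℕ => decide (n.unpair.2 < k))).comp h1

lemma measurable_samplePoint (n : ℕ) : Measurable (samplePoint (E := E) n) := by
  unfold samplePoint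
  fun_prop

lemma pointMeasure_sample_apply (ω : ℕ → ℕ × (ℕ → E)) {B : Set E} (hB : MeasurableSet B) :
    pointMeasure (fun n => sampleUsed n ω) (fun n => samplePoint n ω) B
      = ∑' b, sampleCount B (ω b) := by
  -- The index n encodes a pair (sample, rank in the sample).
  rw [pointMeasure_apply _ _ hB, ← Nat.pairEquiv.tsum_eq, ENNReal.tsum_prod']
  refine tsum_congr fun b => ?_
  rw [tsum_eq_sum (s := Finset.range (ω b).1)]
  · refine Finset.sum_congr rfl fun i hi => ?_
    simp [sampleUsed, samplePoint, Finset.mem_range.1 hi]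
  · intro i hi
    simp only [Finset.mem_range] at hi
    simp [sampleUsed, hi]

lemma measurable_pointMeasure_sample :
    Measurable (fun ω : ℕ → ℕ × (ℕ → E) =>
      pointMeasure (fun n => sampleUsed n ω) (fun n => samplePoint n ω)) := by
  refine Measure.measurable_of_measurable_coe _ fun B hB => ?_
  simp_rw [pointMeasure_sample_apply _ hB]
  exact Measurable.tsum (measurable_sampleCount_apply hB)

variable {μ : Measure E} {r : ℕ → ℝ≥0} {ρ : ℕ → Measure E} [∀ b, IsProbabilityMeasure (ρ b)]

lemma ae_pointMeasure_sample_ne_top (hμ : μ = Measure.sum fun b => (r b : ℝ≥0∞) • ρ b)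
    {B : Set E} (hB : MeasurableSet B) (hμB : μ B ≠ ∞) :
    ∀ᵐ ω ∂Measure.infinitePi (fun b => poissonSampleLaw (r b) (ρ b)),
      pointMeasure (fun n => sampleUsed n ω) (fun n => samplePoint n ω) B ≠ ∞ := by
  have h1 : ∫⁻ ω, pointMeasure (fun n => sampleUsed n ω) (fun n => samplePoint n ω) B
      ∂Measure.infinitePi (fun b => poissonSampleLaw (r b) (ρ b)) = μ B := by
    simp_rw [pointMeasure_sample_apply _ hB]
    rw [lintegral_tsum fun b => (measurable_sampleCount_apply hB b).aemeasurable, hμ,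
      Measure.sum_apply _ hB]
    refine tsum_congr fun b => ?_
    rw [← lintegral_map (measurable_sampleCount hB) (measurable_pi_apply b),
      Measure.infinitePi_map_eval (fun b => poissonSampleLaw (r b) (ρ b)) b,
      lintegral_sampleCount _ _ hB, Measure.smul_apply, smul_eq_mul]
  filter_upwards [ae_lt_top (Measure.measurable_measure.1 measurable_pointMeasure_sample B hB)
    (by rw [h1]; exact hμB)] with ω hω using hω.ne

omit [MeasurableSpace E] in
lemma sampleProd_exp_indicator {ι : Type*} [Fintype ι] (B : ι → Set E) (l : ι → ℝ)
    (q : ℕ × (ℕ → E)) :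
    sampleProd (fun y => exp (I * ((∑ a, l a * ((B a).indicator 1 y : ℝ) : ℝ) : ℂ))) q
      = exp (I * ((∑ a, l a * (sampleCount (B a) q).toReal : ℝ) : ℂ)) := by
  have hc : ∀ a, (sampleCount (B a) q).toReal
      = ∑ i ∈ Finset.range q.1, ((B a).indicator 1 (q.2 i) : ℝ) := by
    intro a
    rw [sampleCount, ENNReal.toReal_sum]
    · refine Finset.sum_congr rfl fun i _ => ?_
      by_cases h : q.2 i ∈ B a <;> simp [h]
    · intro i _
      by_cases h : q.2 i ∈ B a <;> simp [h]
  simp_rw [hc, Finset.mul_sum]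
  rw [Finset.sum_comm, ofReal_sum, Finset.mul_sum, exp_sum]
  rfl

/-- For f = exp(i ∑ l_a 1_{B_a}), disjointness gives f - 1 = ∑ (exp(i l_a) - 1) 1_{B_a}, so the
exponent ∫ (f - 1) dμ splits into Poisson exponents. Both the Poisson laws and the independence of
the counts are read off from it. -/
lemma integral_exp_pointMeasure_sample (hμ : μ = Measure.sum fun b => (r b : ℝ≥0∞) • ρ b)
    {ι : Type*} [Fintype ι] {B : ι → Set E} (hB : ∀ a, MeasurableSet (B a))
    (hμB : ∀ a, μ (B a) ≠ ∞) (hd : Pairwise (fun a b => Disjoint (B a) (B b))) (l : ι → ℝ) :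
    ∫ ω, exp (I * ((∑ a, l a * (pointMeasure (fun n => sampleUsed n ω)
        (fun n => samplePoint n ω) (B a)).toReal : ℝ) : ℂ))
        ∂Measure.infinitePi (fun b => poissonSampleLaw (r b) (ρ b))
      = ∏ a, exp ((μ (B a)).toNNReal * (exp (I * (l a : ℂ)) - 1)) := by
  classical
  obtain ⟨f, hfdef⟩ : ∃ f : E → ℂ,
      f = fun y => exp (I * ((∑ a, l a * ((B a).indicator 1 y : ℝ) : ℝ) : ℂ)) := ⟨_, rfl⟩
  have hf : Measurable f := by
    have := fun a => (measurable_one (α := ℝ) (β := E)).indicator (hB a)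
    rw [hfdef]
    fun_prop
  have hf1 : ∀ y, ‖f y‖ ≤ 1 := fun y => by
    rw [hfdef]
    exact (norm_exp_I_mul _).le
  have hfsub : ∀ y, f y - 1 = ∑ a, (B a).indicator (fun _ => exp (I * (l a : ℂ)) - 1) y := by
    intro y
    by_cases hy : ∃ a, y ∈ B a
    · obtain ⟨a, ha⟩ := hy
      have hne : ∀ b, b ≠ a → y ∉ B b := fun b hb hyb => Set.disjoint_left.1 (hd hb) hyb ha
      rw [Finset.sum_eq_single a (fun b _ hb => by simp [hne b hb]) (by simp), hfdef]
      simp only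
      rw [Finset.sum_eq_single a (fun b _ hb => by simp [hne b hb]) (by simp)]
      simp [ha]
    · push Not at hy
      simp [hfdef, hy]
  have hinti : ∀ a, Integrable ((B a).indicator (fun _ => exp (I * (l a : ℂ)) - 1)) μ := fun a =>
    (integrable_indicator_iff (hB a)).2 (integrableOn_const (hμB a))
  have hint : Integrable (fun y => f y - 1) μ := by
    simp_rw [hfsub]
    exact integrable_finsetSum _ fun a _ => hinti a
  have hval : ∫ y, (f y - 1) ∂μ = ∑ a, (μ (B a)).toNNReal * (exp (I * (l a : ℂ)) - 1) := by
    simp_rw [hfsub]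
    rw [integral_finsetSum _ fun a _ => hinti a]
    refine Finset.sum_congr rfl fun a _ => ?_
    rw [integral_indicator_const _ (hB a), real_smul]
    rfl
  rw [← exp_sum, ← hval]
  have hfin : ∀ᵐ ω ∂Measure.infinitePi (fun b => poissonSampleLaw (r b) (ρ b)),
      ∀ a, ∑' b, sampleCount (B a) (ω b) ≠ ∞ := by
    rw [ae_all_iff]
    intro a
    filter_upwards [ae_pointMeasure_sample_ne_top hμ (hB a) (hμB a)] with ω hω
    rwa [← pointMeasure_sample_apply _ (hB a)]
  have hs : HasSum (fun b => ∫ y, (f y - 1) ∂((r b : ℝ≥0∞) • ρ b)) (∫ y, (f y - 1) ∂μ) := by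
    rw [hμ] at hint ⊢
    exact hasSum_integral_measure hint
  have hind : iIndepFun (fun b (ω : ℕ → ℕ × (ℕ → E)) => sampleProd f (ω b))
      (Measure.infinitePi fun b => poissonSampleLaw (r b) (ρ b)) :=
    iIndepFun_infinitePi (X := fun _ => sampleProd f) fun _ => measurable_sampleProd hf
  refine integral_eq_exp_of_hasSum (F := fun b ω => sampleProd f (ω b))
    (measurable_sampleProd_apply hf) (fun b ω => norm_sampleProd_le_one hf1 _)
    hind (fun b => ?_) hs ?_
  · rw [← integral_sampleProd _ _ hf hf1, ← integral_map
      (φ := fun ω : ℕ → ℕ × (ℕ → E) => ω b) (measurable_pi_apply b).aemeasurable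
      (measurable_sampleProd hf).aestronglyMeasurable,
      Measure.infinitePi_map_eval (fun b => poissonSampleLaw (r b) (ρ b)) b]
  · filter_upwards [hfin] with ω hω
    have hsp : ∀ q : ℕ × (ℕ → E), sampleProd f q
        = exp (I * ((∑ a, l a * (sampleCount (B a) q).toReal : ℝ) : ℂ)) := fun q => by
      rw [hfdef, sampleProd_exp_indicator]
    have hprod : ∀ m, ∏ b ∈ Finset.range m, sampleProd f (ω b) = exp (I * ((∑ a, l a *
        ∑ b ∈ Finset.range m, (sampleCount (B a) (ω b)).toReal : ℝ) : ℂ)) := by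
      intro m
      simp_rw [hsp]
      rw [← exp_sum, ← Finset.mul_sum, ← ofReal_sum, Finset.sum_comm]
      simp_rw [Finset.mul_sum]
    simp_rw [hprod, pointMeasure_sample_apply ω (hB _)]
    have hc : Continuous (fun r : ℝ => exp (I * (r : ℂ))) := by fun_prop
    refine (hc.tendsto _).comp (tendsto_finsetSum _ fun a _ => Tendsto.const_mul (l a) ?_)
    rw [ENNReal.tsum_toReal_eq (ENNReal.ne_top_of_tsum_ne_top (hω a))]
    exact (ENNReal.summable_toReal (hω a)).hasSum.tendsto_sum_nat

lemma integral_exp_poissonMeasure (c : ℝ≥0) (l : ℝ) :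
    ∫ n : ℕ, exp (I * ((l * (n : ℝ) : ℝ) : ℂ)) ∂poissonMeasure c
      = exp (c * (exp (I * (l : ℂ)) - 1)) := by
  rw [← integral_pow_poissonMeasure]
  congr 1
  funext n
  rw [← exp_nat_mul]
  congr 1
  push_cast
  ring

theorem isPoissonRandomMeasure_sample (hμ : μ = Measure.sum fun b => (r b : ℝ≥0∞) • ρ b) :
    IsPoissonRandomMeasure (fun ω : ℕ → ℕ × (ℕ → E) =>
      pointMeasure (fun n => sampleUsed n ω) (fun n => samplePoint n ω)) μ
      (Measure.infinitePi fun b => poissonSampleLaw (r b) (ρ b)) where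
  measurable := measurable_pointMeasure_sample
  hasLaw B hB hμB := by
    have hm := Measure.measurable_measure.1 (measurable_pointMeasure_sample (E := E)) B hB
    refine ⟨hm.aemeasurable, ?_⟩
    have key := map_eq_of_integral_exp_toReal_eq (ι := Unit)
      (P := Measure.infinitePi fun b => poissonSampleLaw (r b) (ρ b))
      (P' := poissonMeasure (μ B).toNNReal)
      (X := fun _ ω => pointMeasure (fun n => sampleUsed n ω) (fun n => samplePoint n ω) B)
      (Y := fun _ (n : ℕ) => (n : ℝ≥0∞)) (fun _ => hm) (fun _ => .of_discrete)
      (fun _ => ae_pointMeasure_sample_ne_top hμ hB hμB) (fun _ => by simp) fun l => by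
        rw [integral_exp_pointMeasure_sample hμ (B := fun _ : Unit => B) (fun _ => hB)
          (fun _ => hμB) (fun a b hab => (hab (Subsingleton.elim a b)).elim) l]
        simp only [ENNReal.toReal_natCast, Finset.univ_unique, Finset.sum_singleton,
          Finset.prod_singleton]
        exact (integral_exp_poissonMeasure _ _).symm
    have key2 := congrArg (fun m => Measure.map (fun v : Unit → ℝ≥0∞ => v ()) m) key
    beta_reduce at key2
    rw [Measure.map_map (by fun_prop) (measurable_pi_lambda _ fun _ => hm),
      Measure.map_map (by fun_prop) .of_discrete] at key2
    exact key2
  indep k B hB hμB hd := by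
    have hm := fun i => Measure.measurable_measure.1 (measurable_pointMeasure_sample (E := E)) _
      (hB i)
    have key := iIndepFun_of_integral_exp_toReal (κ := fun _ : Fin k => Unit)
      (P := Measure.infinitePi fun b => poissonSampleLaw (r b) (ρ b))
      (X := fun i _ ω =>
        pointMeasure (fun n => sampleUsed n ω) (fun n => samplePoint n ω) (B i))
      (fun i _ => hm i) (fun i _ => ae_pointMeasure_sample_ne_top hμ (hB i) (hμB i)) fun l => by
        simp only [Finset.univ_unique, Finset.sum_singleton]
        rw [integral_exp_pointMeasure_sample hμ hB hμB hd (fun i => l i default)]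
        refine Finset.prod_congr rfl fun i _ => ?_
        have h1 := integral_exp_pointMeasure_sample hμ (B := fun _ : Unit => B i) (fun _ => hB i)
          (fun _ => hμB i) (fun a b hab => (hab (Subsingleton.elim a b)).elim)
          (fun _ => l i default)
        simp only [Finset.univ_unique, Finset.sum_singleton, Finset.prod_singleton] at h1
        exact h1.symm
    exact key.comp (fun _ (v : Unit → ℝ≥0∞) => v ()) (fun _ => by fun_prop)

end PoissonExistence

/-! ### Existence of the reinforced construction -/

section Construction

variable {Ω Ω' : Type*} [MeasurableSpace Ω] [MeasurableSpace Ω'] {P : Measure Ω} {P' : Measure Ω'}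

lemma IsPoissonRandomMeasure.comp_measurePreserving {E : Type*} [MeasurableSpace E]
    {M : Ω → Measure E} {μ : Measure E} (hM : IsPoissonRandomMeasure M μ P) {φ : Ω' → Ω}
    (hφ : MeasurePreserving φ P' P) : IsPoissonRandomMeasure (fun ω => M (φ ω)) μ P' where
  measurable := hM.measurable.comp hφ.measurable
  hasLaw B hB hμB := (hM.hasLaw B hB hμB).fun_comp hφ.hasLaw
  indep k B hB hμB hd := (iIndepFun_comp_iff (f := fun i ω => M ω (B i))
    (fun i => Measure.measurable_measure.1 hM.measurable _ (hB i)) hφ).2 (hM.indep k B hB hμB hd)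

lemma IsPoissonWithDecorations.comp_measurePreserving {ν : Measure ℝ} {p : ℝ}
    {used : ℕ → Ω → Bool} {x : ℕ → Ω → ℝ≥0 × ℝ} {T : ℕ → Ω → ℕ → ℝ}
    (h : IsPoissonWithDecorations ν p used x T P) {φ : Ω' → Ω} (hφ : MeasurePreserving φ P' P) :
    IsPoissonWithDecorations ν p (fun n ω => used n (φ ω)) (fun n ω => x n (φ ω))
      (fun n ω => T n (φ ω)) P' where
  measurable_used n := (h.measurable_used n).comp hφ.measurable
  measurable_point n := (h.measurable_point n).comp hφ.measurable
  measurable_times n := (h.measurable_times n).comp hφ.measurable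
  poisson := h.poisson.comp_measurePreserving hφ
  law_times n := (h.law_times n).fun_comp hφ.hasLaw
  indep_times := (iIndepFun_comp_iff h.measurable_times hφ).2 h.indep_times
  indep_points_times := by
    have h1 : Measurable (fun ω n => (used n ω, x n ω)) := measurable_pi_lambda _ fun n =>
      (h.measurable_used n).prodMk (h.measurable_point n)
    have h2 : Measurable (fun ω n => T n ω) := measurable_pi_lambda _ h.measurable_times
    have h3 := h.indep_points_times
    rw [indepFun_iff_measure_inter_preimage_eq_mul] at h3 ⊢
    intro s t hs ht
    have h4 := hφ.measure_preimage ((h1 hs).inter (h2 ht)).nullMeasurableSet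
    rw [h3 s t hs ht, ← hφ.measure_preimage (h1 hs).nullMeasurableSet,
      ← hφ.measure_preimage (h2 ht).nullMeasurableSet] at h4
    exact h4

/-- The intensity is a countable sum of finite measures, each a multiple of a probability measure;
the Poisson samples drawn from these are put on a product space with an i.i.d. sequence of birth
times. -/
theorem exists_isPoissonWithDecorations (ν : Measure ℝ) [SFinite ν] {p : ℝ} (hp : 0 < p) :
    ∃ (Ω : Type) (_ : MeasurableSpace Ω) (P : Measure Ω) (used : ℕ → Ω → Bool)
      (x : ℕ → Ω → ℝ≥0 × ℝ) (T : ℕ → Ω → ℕ → ℝ),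
      IsProbabilityMeasure P ∧ IsPoissonWithDecorations ν p used x T P := by
  have := isProbabilityMeasure_birthTimesLaw hp
  have hsf : SFinite (ancestorIntensity p ν) := inferInstance
  choose ρ r hρ hr using fun b => exists_isProbabilityMeasure_smul
    (sfiniteSeq (ancestorIntensity p ν) b)
  have hμ : ancestorIntensity p ν = Measure.sum fun b => (r b : ℝ≥0∞) • ρ b := by
    simp_rw [← hr]
    exact (sum_sfiniteSeq _).symm
  let P₀ := Measure.infinitePi fun b => poissonSampleLaw (r b) (ρ b)
  let P₁ := Measure.infinitePi fun _ : ℕ => birthTimesLaw p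
  have hfst : MeasurePreserving Prod.fst (P₀.prod P₁) P₀ := measurePreserving_fst
  have hsnd : MeasurePreserving Prod.snd (P₀.prod P₁) P₁ := measurePreserving_snd
  refine ⟨(ℕ → ℕ × (ℕ → ℝ≥0 × ℝ)) × (ℕ → ℕ → ℝ), inferInstance, P₀.prod P₁,
    fun n ω => sampleUsed n ω.1, fun n ω => samplePoint n ω.1, fun n ω => ω.2 n, inferInstance,
    fun n => (measurable_sampleUsed n).comp measurable_fst,
    fun n => (measurable_samplePoint n).comp measurable_fst, fun n => by fun_prop,
    (isPoissonRandomMeasure_sample hμ).comp_measurePreserving hfst, fun n => ?_, ?_, ?_⟩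
  · exact (measurePreserving_eval_infinitePi (fun _ : ℕ => birthTimesLaw p) n).hasLaw.fun_comp
      hsnd.hasLaw
  · exact (iIndepFun_comp_iff (f := fun n (w : ℕ → ℕ → ℝ) => w n)
      (fun n => measurable_pi_apply n) hsnd).2
      (iIndepFun_infinitePi (X := fun _ y => y) fun _ => measurable_id)
  · exact indepFun_prod (X := fun (ω : ℕ → ℕ × (ℕ → ℝ≥0 × ℝ)) n =>
      (sampleUsed n ω, samplePoint n ω)) (Y := fun w : ℕ → ℕ → ℝ => w)
      (measurable_pi_lambda _ fun n => (measurable_sampleUsed n).prodMk (measurable_samplePoint n))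
      measurable_id

theorem exists_isReinforcedConstruction (Λ : Measure ℝ) [SigmaFinite Λ] {p : ℝ} (hp : 0 < p) :
    ∃ (Ω : Type) (_ : MeasurableSpace Ω) (P : Measure Ω) (A : ℕ → Set ℝ)
      (used : ℕ → ℕ → Ω → Bool) (x : ℕ → ℕ → Ω → ℝ≥0 × ℝ) (T : ℕ → ℕ → Ω → ℕ → ℝ),
      IsProbabilityMeasure P ∧ IsReinforcedConstruction Λ p A used x T P := by
  let A : ℕ → Set ℝ := disjointed (spanningSets Λ)
  choose Ω mΩ P used x T hP h using fun j =>
    exists_isPoissonWithDecorations (Λ.restrict (A j)) hp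
  refine ⟨(j : ℕ) → Ω j, inferInstance, Measure.infinitePi P, A, fun j n ω => used j n (ω j),
    fun j n ω => x j n (ω j), fun j n ω => T j n (ω j), inferInstance,
    MeasurableSet.disjointed (measurableSet_spanningSets Λ), disjoint_disjointed _, ?_, fun j => ?_,
    fun j => ?_, ?_⟩
  · rw [iUnion_disjointed, iUnion_spanningSets]
  · exact (measure_mono (disjointed_subset _ j)).trans_lt (measure_spanningSets_lt_top Λ j)
  · exact (h j).comp_measurePreserving (measurePreserving_eval_infinitePi P j)
  · exact iIndepFun_infinitePi (X := fun j ω n => (used j n ω, x j n ω, T j n ω)) fun j =>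
      measurable_pi_lambda _ fun n => ((h j).measurable_used n).prodMk
        (((h j).measurable_point n).prodMk ((h j).measurable_times n))

end Construction

/-! ### The characterization -/

section Characterization

variable {Ω : Type*} [MeasurableSpace Ω] {P : Measure Ω} {Λ : Measure ℝ} {p : ℝ}

lemma IsReinforcedConstruction.hasReinforcedCounts [IsProbabilityMeasure P] [SigmaFinite Λ]
    {A : ℕ → Set ℝ} {used : ℕ → ℕ → Ω → Bool} {x : ℕ → ℕ → Ω → ℝ≥0 × ℝ} {T : ℕ → ℕ → Ω → ℕ → ℝ}
    (h : IsReinforcedConstruction Λ p A used x T P) (hp : p ∈ Set.Ioo (0 : ℝ) 1) :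
    HasReinforcedCounts Λ p (superposition used x T) P where
  process _ hB hΛB := h.isReinforcedPoissonProcess_count hp hB hΛB.ne
  indep _ _ hB hΛB hd := h.iIndepFun_counts hp.1 hB (fun i => (hΛB i).ne) hd

/-- The two conditions depend on the law of N only, which is what carries them from the space of the
construction to Ω. -/
lemma hasReinforcedCounts_id_map_iff {N : Ω → Measure (ℝ≥0 × ℝ)} (hN : Measurable N) :
    HasReinforcedCounts Λ p id (P.map N) ↔ HasReinforcedCounts Λ p N P := by
  have hpres : MeasurePreserving N P (P.map N) := ⟨hN, rfl⟩
  have hm : ∀ {A : Set ℝ}, MeasurableSet A → ∀ t : ℝ≥0,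
      Measurable (countingProcess (id : Measure (ℝ≥0 × ℝ) → _) A t) := fun hA t =>
    Measure.measurable_coe (measurableSet_Icc.prod hA)
  have hind : ∀ (k : ℕ) (A : Fin k → Set ℝ), (∀ i, MeasurableSet (A i)) →
      (iIndepFun (fun i ω t => countingProcess N (A i) t ω) P ↔
        iIndepFun (fun i m t => countingProcess id (A i) t m) (P.map N)) := fun k A hA =>
    iIndepFun_comp_iff (f := fun i m t => countingProcess id (A i) t m)
      (fun i => measurable_pi_lambda _ (hm (hA i))) hpres
  have hfin : ∀ {A : Set ℝ}, MeasurableSet A → ∀ t : ℝ≥0,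
      ((∀ᵐ m ∂P.map N, countingProcess id A t m ≠ ∞) ↔ ∀ᵐ ω ∂P, countingProcess N A t ω ≠ ∞) :=
    fun hA t => ae_map_iff hN.aemeasurable (hm hA t (measurableSet_singleton ∞)).compl
  have hint : ∀ {A : Set ℝ}, MeasurableSet A → ∀ (k : ℕ) (s : Fin k → ℝ≥0) (l : Fin k → ℝ),
      ∫ m, exp (I * ((∑ i, l i * (countingProcess id A (s i) m).toReal : ℝ) : ℂ)) ∂P.map N
        = ∫ ω, exp (I * ((∑ i, l i * (countingProcess N A (s i) ω).toReal : ℝ) : ℂ)) ∂P := by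
    intro A hA k s l
    have := fun i => (hm hA (s i)).ennreal_toReal
    exact integral_map hN.aemeasurable (Measurable.aestronglyMeasurable (by fun_prop))
  refine ⟨fun h => ⟨fun A hA hΛA => ⟨fun t => (hm hA t).comp hN, fun t => ?_, ?_⟩, ?_⟩,
    fun h => ⟨fun A hA hΛA => ⟨hm hA, fun t => ?_, ?_⟩, ?_⟩⟩
  · exact (hfin hA t).1 ((h.process A hA hΛA).finite t)
  · intro k s t l
    rw [← hint hA]
    exact (h.process A hA hΛA).charFun k s t l
  · intro k A hA hΛA hd
    exact (hind k A hA).2 (h.indep k A hA hΛA hd)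
  · exact (hfin hA t).2 ((h.process A hA hΛA).finite t)
  · intro k s t l
    rw [hint hA]
    exact (h.process A hA hΛA).charFun k s t l
  · intro k A hA hΛA hd
    exact (hind k A hA).1 (h.indep k A hA hΛA hd)

theorem isReinforcedPoissonPointProcess_iff [IsProbabilityMeasure P] [SigmaFinite Λ]
    (hp : p ∈ Set.Ioo (0 : ℝ) 1) {N : Ω → Measure (ℝ≥0 × ℝ)} (hN : Measurable N) :
    IsReinforcedPoissonPointProcess Λ p N P ↔ HasReinforcedCounts Λ p N P := by
  constructor
  · rintro ⟨Ω', _, P', A, used, x, T, hP', hA, hd, hU, hΛ, hdec, hind, hlaw⟩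
    have h : IsReinforcedConstruction Λ p A used x T P' := ⟨hA, hd, hU, hΛ, hdec, hind⟩
    rw [← hasReinforcedCounts_id_map_iff hN, hlaw]
    exact (hasReinforcedCounts_id_map_iff h.measurable_superposition).2 (h.hasReinforcedCounts hp)
  · intro h
    obtain ⟨Ω', _, P', A, used, x, T, hP', h'⟩ := exists_isReinforcedConstruction Λ hp.1
    exact ⟨Ω', _, P', A, used, x, T, hP', h'.measurableSet, h'.disjoint, h'.iUnion_eq,
      h'.measure_lt_top, h'.decorations, h'.indep,
      h.map_eq (h'.hasReinforcedCounts hp) hN h'.measurable_superposition⟩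

end Characterization

end NoiseReinforced

theorem mainTheorem11 {Ω : Type*} [MeasurableSpace Ω] (P : Measure Ω) [IsProbabilityMeasure P]
    (Λ : Measure ℝ) [SigmaFinite Λ] (p : ℝ) (hp : p ∈ Set.Ioo (0 : ℝ) 1)
    (N : Ω → Measure (ℝ≥0 × ℝ)) (hN : NoiseReinforced.IsPointProcess N P) :
    NoiseReinforced.IsReinforcedPoissonPointProcess Λ p N P ↔
      (∀ A : Set ℝ, MeasurableSet A → Λ A < ∞ →
        NoiseReinforced.IsReinforcedPoissonProcess (Λ A).toReal p
          (NoiseReinforced.countingProcess N A) P) ∧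
      (∀ (k : ℕ) (A : Fin k → Set ℝ), (∀ i, MeasurableSet (A i)) → (∀ i, Λ (A i) < ∞) →
        Pairwise (fun i j => Disjoint (A i) (A j)) →
        iIndepFun (fun i ω t => NoiseReinforced.countingProcess N (A i) t ω) P) := by
  rw [NoiseReinforced.isReinforcedPoissonPointProcess_iff hp hN.measurable]
  exact ⟨fun h => ⟨h.process, h.indep⟩, fun h => ⟨h.1, h.2⟩⟩
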